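/- Let $d\ge 1$, $b,x_0\in\mathbb R^d$, $D_f>0$, and let $\alpha=p/q\in(0,1)$ with $p,q$ positive integers, $\gcd(p,q)=1$. Let $u(x,t)$, $t>0$, be the solution of the fractional Fokker–Planck equation without ordinary diffusion, $$\partial_t u=-b\cdot\nabla u-D_f(-\Delta)^{\alpha}u\quad\text{on }\mathbb R^d\times(0,\infty),\qquad u(\cdot,0)=\delta_{x_0},$$ that is, every $u(\cdot,t)$ is a continuous probability density, $\frac{d}{dt}\int u f\,dx=\int u\,\bigl(b\cdot\nabla f-D_f(-\Delta)^\alpha f\bigr)dx$ for all $t>0$ and $\int u(x,t)f(x)\,dx\to f(x_0)$ as $t\to0^+$, for every Schwartz function $f$, where $(-\Delta)^\alpha$ is the Fourier multiplier $|k|^{2\alpha}$. Write $$\tau=D_ft,\qquad y=|x-x_0-bt|,\qquad z=-\frac{(y/2)^2}{\tau^{q/p}},\qquad w=\frac{z^pq^q}{p^{2p}},$$ let $S_{n-1}$ be the surface area of the unit sphere of $\mathbb R^n$, let ${}_rF_s(a_1,\dots,a_r;b_1,\dots,b_s;w)=\sum_{n\ge0}\frac{(a_1)_n\cdots(a_r)_n}{(b_1)_n\cdots(b_s)_n}\frac{w^n}{n!}$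 with $(a)_n=a(a+1)\cdots(a+n-1)$, and consider the formula $$u(x,t)=\frac{\tau^{-\frac{d}{2p/q}}}{(2\pi)^d}\sum_{i=0}^{p-1}\frac{S_{d+2i-1}\,\Gamma\!\left(\frac{d+2i}{2p/q}+1\right)z^i}{i!\,(d+2i)\,\pi^i}\;{}_{q-1}F_{2p-2}\!\left(\Bigl\{\tfrac{d+2i}{2p}+\tfrac jq\Bigr\}_{j=1}^{q-1};\Bigl\{\tfrac{i+1+j}{p}\Bigr\}_{\substack{0\le j\le p-1\\ i+1+j\ne p}},\Bigl\{\tfrac{d+2i+2j}{2p}\Bigr\}_{j=1}^{p-1};w\right).\tag{$*$}$$ 1. If $\alpha>1/2$, or $\alpha=1/2$ and $y<\tau$, or $y=0$, the hypergeometric series in $(*)$ converge and $(*)$ holds. 2. If $\alpha=1/2$, then $(*)$ holds for all $y\ge0$ when the hypergeometric function, defined by its series for $|w|<1$, is continued analytically to $\mathbb C\setminus[1,\infty)$. 3. If $\alpha<1/2$ and $y>0$, every hypergeometric series in $(*)$ diverges. 4. For every such $\alpha$, $(*)$ holds formally: for $y>0$, with $\nu=(d-2)/2$ and $J_\nu(s)=\sum_{m\ge0}\frac{(-1)^m}{m!\,\Gamma(\nu+m+1)}(s/2)^{\nu+2m}$,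 $$u(x,t)=\frac1{y^{\nu}}\int_0^\infty\Bigl(\frac r{2\pi}\Bigr)^{d/2}J_\nu(yr)\,e^{-D_fr^{2\alpha}t}\,dr$$ with an integrable integrand, and if $J_\nu(yr)$ is replaced in this expression by the term of index $m=pn+i$ ($0\le i<p$, $n\ge0$) of its power series, the integrand is again integrable and the result is exactly the $n$-th term of the $i$-th summand of the right-hand side of $(*)$ (including all prefactors). 5. For every such $\alpha$, $(*)$ is the complete asymptotic expansion of the solution at $y\to0$: for every $t>0$ and $N\ge0$, the difference between $u(x,t)$ and the right-hand side of $(*)$ with each hypergeometric series cut off after its first $N$ terms is $O(y^{2pN})$ as $y\to0$. 6. If $\alpha=1/3$, the right-hand side of $(*)$ is, term by term, the single series $$\frac{S_{d-1}\,\Gamma\!\left(\frac{3d}{2}+1\right)}{(2\pi)^d\,\tau^{3d/2}\,d}\;{}_2F_0\!\left(\tfrac d2+\tfrac13,\tfrac d2+\tfrac23;\;;-\frac{3^3(y/2)^2}{\tau^3}\right),$$ and for every $t>0$ and $N\ge0$ this expression, cut off after the first $N$ terms of ${}_2F_0$, differs from $u(x,t)$ by $O(y^{2N})$ as $y\to0$.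 -/

import Mathlib

open Real Set Filter Topology MeasureTheory Asymptotics
open scoped FourierTransform SchwartzMap

noncomputable section

/-- The fractional Laplacian `(-Δ)^α f` of a Schwartz function on `ℝ^d`: the Fourier multiplier with
symbol `|k|^(2α)`. Mathlib's transform uses the frequency variable `ξ = k / (2π)`. -/
def fracLaplacian {d : ℕ} (α : ℝ) (f : 𝓢(EuclideanSpace ℝ (Fin d), ℂ)) :
    EuclideanSpace ℝ (Fin d) → ℂ :=
  𝓕⁻ (fun ξ : EuclideanSpace ℝ (Fin d) =>
    (((2 * π * ‖ξ‖) ^ (2 * α) : ℝ) : ℂ) * 𝓕 (f : EuclideanSpace ℝ (Fin d) → ℂ) ξ)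

/-- `u x t` is a (weak) solution, made of continuous probability densities, of
`∂ₜ u = - b · ∇u + D_o Δu - D_f (-Δ)^α u` on `ℝ^d × (0, ∞)`, with `u(·, 0) = δ_{x₀}`. The equation and
the initial condition are tested against all Schwartz functions. -/
structure IsFundamentalSolution {d : ℕ} (b x₀ : EuclideanSpace ℝ (Fin d)) (Do Df α : ℝ)
    (u : EuclideanSpace ℝ (Fin d) → ℝ → ℝ) : Prop where
  continuous : ∀ t, 0 < t → Continuous fun x => u x t
  nonneg : ∀ t, 0 < t → ∀ x, 0 ≤ u x t
  integrable : ∀ t, 0 < t → Integrable fun x => u x t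
  integral_eq_one : ∀ t, 0 < t → ∫ x, u x t = 1
  equation : ∀ f : 𝓢(EuclideanSpace ℝ (Fin d), ℂ), ∀ t, 0 < t →
    HasDerivAt (fun s => ∫ x, (u x s : ℂ) * f x)
      (∫ x, (u x t : ℂ) *
        (fderiv ℝ f x b + (Do : ℂ) * Laplacian.laplacian (f : EuclideanSpace ℝ (Fin d) → ℂ) x
          - (Df : ℂ) * fracLaplacian α f x)) t
  initial : ∀ f : 𝓢(EuclideanSpace ℝ (Fin d), ℂ),
    Tendsto (fun t => ∫ x, (u x t : ℂ) * f x) (𝓝[>] (0 : ℝ)) (𝓝 (f x₀))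

/-- The surface area of the unit sphere of `ℝ^n`, written `S_{n-1}` in the mathematical notation. -/
def unitSphereArea (n : ℕ) : ℝ :=
  ((volume : Measure (EuclideanSpace ℝ (Fin n))).toSphere).real univ

/-- The `n`-th term `((a₁)ₙ ⋯ (a_r)ₙ) / ((b₁)ₙ ⋯ (b_s)ₙ) * wⁿ / n!` of the generalized hypergeometric
series `_rF_s(a₁, …, a_r; b₁, …, b_s; w)`. -/
def hypTerm {𝕜 : Type*} [Field 𝕜] (a b : Multiset 𝕜) (w : 𝕜) (n : ℕ) : 𝕜 :=
  (a.map fun c => (ascPochhammer 𝕜 n).eval c).prod /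
    (b.map fun c => (ascPochhammer 𝕜 n).eval c).prod * (w ^ n / (n.factorial : 𝕜))

/-- The generalized hypergeometric function `_rF_s(a₁, …, a_r; b₁, …, b_s; w)`. -/
def hypFun (a b : Multiset ℝ) (w : ℝ) : ℝ := ∑' n, hypTerm a b w n

/-- The `q - 1` upper parameters `(d + 2i) / (2p) + j / q`, `j = 1, …, q - 1`. -/
def upperParams (d p q i : ℕ) : Multiset ℝ :=
  (Finset.Icc 1 (q - 1)).val.map fun j => ((d : ℝ) + 2 * i) / (2 * p) + (j : ℝ) / q

/-- The `2p - 2` lower parameters: `(i + 1 + j) / p` for `j = 0, …, p - 1` with `i + 1 + j ≠ p`, and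
`(d + 2i + 2j) / (2p)` for `j = 1, …, p - 1`. -/
def lowerParams (d p i : ℕ) : Multiset ℝ :=
  (((Finset.range p).filter fun j => i + 1 + j ≠ p).val.map fun j => ((i : ℝ) + 1 + j) / p) +
    ((Finset.Icc 1 (p - 1)).val.map fun j => ((d : ℝ) + 2 * i + 2 * j) / (2 * p))

/-- `z = -(y/2)² / τ^{q/p}`, where `τ = D_f t`. -/
def zVar (p q : ℕ) (τ y : ℝ) : ℝ := -(y / 2) ^ 2 / τ ^ ((q : ℝ) / p)

/-- The argument `z^p q^q / p^{2p}` of the hypergeometric functions. -/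
def hypArg (p q : ℕ) (τ y : ℝ) : ℝ := zVar p q τ y ^ p * (q : ℝ) ^ q / (p : ℝ) ^ (2 * p)

/-- The factor `τ^{-d/(2p/q)} / (2π)^d` in front of the sum. -/
def prefactor (d p q : ℕ) (τ : ℝ) : ℝ := τ ^ (-(d : ℝ) / (2 * p / q)) / (2 * π) ^ d

/-- The factor `S_{d+2i-1} Γ((d+2i)/(2p/q) + 1) zⁱ / (i! (d+2i) πⁱ)` of the `i`-th summand. -/
def gammaFactor (d p q : ℕ) (τ y : ℝ) (i : ℕ) : ℝ :=
  unitSphereArea (d + 2 * i) * Gamma (((d : ℝ) + 2 * i) / (2 * p / q) + 1) * zVar p q τ y ^ i /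
    ((i.factorial : ℝ) * ((d : ℝ) + 2 * i) * π ^ i)

/-- The closed formula, a sum of `p` explicit factors times `_{q-1}F_{2p-2}`. -/
def pureFormula (d p q : ℕ) (τ y : ℝ) : ℝ :=
  prefactor d p q τ * ∑ i ∈ Finset.range p, gammaFactor d p q τ y i *
    hypFun (upperParams d p q i) (lowerParams d p i) (hypArg p q τ y)

/-- The closed formula with every hypergeometric series cut off after its first `N` terms. -/
def pureFormulaTrunc (d p q : ℕ) (τ y : ℝ) (N : ℕ) : ℝ :=
  prefactor d p q τ * ∑ i ∈ Finset.range p, gammaFactor d p q τ y i *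
    ∑ n ∈ Finset.range N, hypTerm (upperParams d p q i) (lowerParams d p i) (hypArg p q τ y) n

/-- The `m`-th term `(-1)^m / (m! Γ(ν+m+1)) * (x/2)^{ν+2m}` of the power series of `J_ν`, `x > 0`. -/
def besselTerm (ν x : ℝ) (m : ℕ) : ℝ :=
  (-1) ^ m / ((m.factorial : ℝ) * Gamma (ν + m + 1)) * (x / 2) ^ (ν + 2 * m)

/-- The Bessel function of the first kind `J_ν(x)`, `x > 0`. -/
def besselJ (ν x : ℝ) : ℝ := ∑' m, besselTerm ν x m

end

/-!
The proof identifies the solution explicitly and expands the result in powers of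
`y = ‖x - x₀ - t • b‖`.

Testing the equation with the Fourier transforms of smooth functions supported away from the origin
turns it into multiplication by the continuous function `symbol`. Its iterates are bounded on the
support of such a function, so the equation determines the Fourier transform of the solution
(`IsFundamentalSolution.integral_sub_mul_eq_zero`), and Fourier inversion gives
`u x t = (2π)^{-d} ∫ exp (i ⟪ξ, x - x₀ - t • b⟫) exp (-D_f t ‖ξ‖^{2α}) dξ`
(`IsFundamentalSolution.eq_integral_cexp`).

In polar coordinates the angular integral is `sphereCos`, the integral of the plane wave
`cos ⟪ω, v⟫` over the unit sphere. The even moments of the sphere, computed from Gaussian integrals,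
give its power series, which is that of a Bessel function; and since a Taylor polynomial of the
cosine errs by at most the first omitted term, so do the partial sums for `sphereCos`
(`abs_sphereCos_sub_sum_le`). Integrating against the radial weight, the same holds for the solution
and the sums of the terms `expansionTerm` (`IsFundamentalSolution.abs_sub_sum_expansionTerm_le`).
Splitting the index modulo `p` and using the multiplication formula for Pochhammer symbols, these
terms are exactly those of the `p` hypergeometric series (`expansionTerm_eq`). The error bound
therefore gives both the asymptotic expansion and, when the terms tend to zero, the closed formula;
convergence and divergence of the series are decided by the quotient of consecutive terms.

For `α = 1/2` the hypergeometric function is `(1 - w)^{-(d+1)/2}`, and the integral is analytic in a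
complex strip of distances `y`, so the identity theorem extends the formula to all `y`
(`IsFundamentalSolution.eq_poisson`).
-/

section

open scoped RealInnerProductSpace

/-! ### Pochhammer symbols and the terms of the expansion -/

theorem ascPochhammer_eval_add {R : Type*} [CommRing R] (k m : ℕ) (x : R) :
    (ascPochhammer R (k + m)).eval x =
      (ascPochhammer R k).eval x * (ascPochhammer R m).eval (x + k) := by
  rw [← ascPochhammer_mul]; simp

theorem ascPochhammer_eval_eq_prod {R : Type*} [CommRing R] (n : ℕ) (x : R) :
    (ascPochhammer R n).eval x = ∏ j ∈ Finset.range n, (x + j) := by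
  induction n with
  | zero => simp
  | succ n ih => rw [ascPochhammer_succ_eval, ih, Finset.prod_range_succ]

/-- The multiplication formula `(x)_{mn} = m^{mn} ∏_{j<m} ((x + j) / m)_n`. -/
theorem ascPochhammer_eval_mul_nat {m : ℕ} (hm : 0 < m) (n : ℕ) (x : ℝ) :
    (ascPochhammer ℝ (m * n)).eval x =
      (m : ℝ) ^ (m * n) * ∏ j ∈ Finset.range m, (ascPochhammer ℝ n).eval ((x + j) / m) := by
  have hm' : (m : ℝ) ≠ 0 := by positivity
  induction n with
  | zero => simp
  | succ n ih =>
    have h : ∏ j ∈ Finset.range m, (x + (m * n : ℕ) + j)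
        = (m : ℝ) ^ m * ∏ j ∈ Finset.range m, ((x + j) / m + n) := by
      rw [← Finset.card_range m, ← Finset.prod_const, Finset.card_range,
        ← Finset.prod_mul_distrib]
      refine Finset.prod_congr rfl fun j _ => ?_
      field_simp
      push_cast
      ring
    simp_rw [ascPochhammer_succ_eval]
    rw [mul_add, mul_one, ascPochhammer_eval_add, ih, ascPochhammer_eval_eq_prod m, h,
      Finset.prod_mul_distrib, pow_add]
    ring

theorem Gamma_add_nat {x : ℝ} (hx : 0 < x) (n : ℕ) :
    Gamma (x + n) = (ascPochhammer ℝ n).eval x * Gamma x := by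
  induction n with
  | zero => simp
  | succ n ih =>
    rw [ascPochhammer_succ_eval, Nat.cast_succ, ← add_assoc, Gamma_add_one (by positivity), ih]
    ring

theorem unitSphereArea_eq {n : ℕ} (hn : 0 < n) :
    unitSphereArea n = 2 * π ^ ((n : ℝ) / 2) / Gamma ((n : ℝ) / 2) := by
  have : Nonempty (Fin n) := ⟨⟨0, hn⟩⟩
  have hn' : (0 : ℝ) < n := by exact_mod_cast hn
  have hG := Gamma_pos_of_pos (half_pos hn')
  rw [unitSphereArea, Measure.toSphere_real_apply_univ, Measure.real, EuclideanSpace.volume_ball]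
  simp only [finrank_euclideanSpace, Fintype.card_fin, ENNReal.ofReal_one, one_pow, one_mul]
  rw [ENNReal.toReal_ofReal (by positivity), Gamma_add_one (by positivity), sqrt_eq_rpow,
    ← rpow_natCast, ← rpow_mul pi_pos.le]
  field_simp

/-- The multiplication formula for `Γ (q (a + n))`. The factor `(a)_n` is kept apart: it occurs once
in the numerator and once in the denominator of `expansionTerm`, and cancels. -/
theorem Gamma_nat_mul_add {q : ℕ} (hq : 0 < q) {a : ℝ} (ha : 0 < a) (n : ℕ) :
    Gamma (q * a + (q * n : ℕ)) = (q : ℝ) ^ (q * n) * ((ascPochhammer ℝ n).eval a *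
      ∏ j ∈ Finset.Icc 1 (q - 1), (ascPochhammer ℝ n).eval (a + (j : ℝ) / q)) * Gamma (q * a) := by
  have hq' : (q : ℝ) ≠ 0 := by positivity
  rw [Gamma_add_nat (by positivity), ascPochhammer_eval_mul_nat hq]
  congr 2
  obtain ⟨r, rfl⟩ : ∃ r, q = r + 1 := ⟨q - 1, by omega⟩
  rw [Finset.prod_range_succ', mul_comm, Nat.add_sub_cancel]
  congr 1
  · congr 1; push_cast at hq' ⊢; field_simp; simp
  · rw [Finset.range_eq_Ico, Finset.prod_Ico_add' (fun j : ℕ =>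
      Polynomial.eval ((((r + 1 : ℕ) : ℝ) * a + (j : ℝ)) / ((r + 1 : ℕ) : ℝ)) (ascPochhammer ℝ n))]
    refine Finset.prod_congr (by ext; simp) fun j _ => ?_
    push_cast at hq' ⊢; field_simp

theorem factorial_mul_add {p i : ℕ} (hi : i < p) (n : ℕ) :
    ((p * n + i).factorial : ℝ) = (p : ℝ) ^ (p * n) * ((n.factorial : ℝ) *
      ∏ j ∈ (Finset.range p).filter (fun j => i + 1 + j ≠ p),
        (ascPochhammer ℝ n).eval (((i : ℝ) + 1 + j) / p)) * (i.factorial : ℝ) := by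
  have hp : 0 < p := by omega
  have hp' : (p : ℝ) ≠ 0 := by positivity
  rw [← Gamma_nat_eq_factorial, ← Gamma_nat_eq_factorial i,
    show ((p * n + i : ℕ) : ℝ) + 1 = ((i : ℝ) + 1) + (p * n : ℕ) by push_cast; ring,
    Gamma_add_nat (by positivity), ascPochhammer_eval_mul_nat hp]
  congr 2
  have hmem : p - 1 - i ∈ Finset.range p := by simp; omega
  rw [← Finset.mul_prod_erase _ _ hmem]
  congr 1
  -- the index with `i + 1 + j = p` contributes `(1)_n = n!`
  · rw [show ((i : ℝ) + 1 + ((p - 1 - i : ℕ) : ℝ)) / p = 1 by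
      rw [div_eq_one_iff_eq hp']; norm_cast; omega]
    exact ascPochhammer_eval_one ℝ n
  · refine Finset.prod_congr ?_ fun _ _ => rfl
    ext j; simp; omega

/-- The parameters are real numbers attached to natural indices, so `upperParams` is a
`Multiset.bind` of casts; this turns the product over it into one over the indices. -/
theorem prod_map_upperParams {M : Type*} [CommMonoid M] (d p q i : ℕ) (f : ℝ → M) :
    ((upperParams d p q i).map f).prod =
      ∏ j ∈ Finset.Icc 1 (q - 1), f (((d : ℝ) + 2 * i) / (2 * p) + (j : ℝ) / q) := by
  simp [upperParams, Multiset.bind_def, Multiset.pure_def, Multiset.map_map]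

theorem prod_map_lowerParams {M : Type*} [CommMonoid M] (d p i : ℕ) (f : ℝ → M) :
    ((lowerParams d p i).map f).prod =
      (∏ j ∈ (Finset.range p).filter (fun j => i + 1 + j ≠ p), f (((i : ℝ) + 1 + j) / p)) *
        ∏ j ∈ Finset.Icc 1 (p - 1), f (((d : ℝ) + 2 * i + 2 * j) / (2 * p)) := by
  simp [lowerParams, Multiset.bind_def, Multiset.pure_def, Multiset.map_map]
  rfl

/-- The `m`-th term of the expansion in powers of `y = |x - x₀ - tb|` of the solution,
for `τ = D_f t` and `α = p / q`. -/
noncomputable def expansionTerm (d p q : ℕ) (τ y : ℝ) (m : ℕ) : ℝ :=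
  (-1) ^ m * 2 * π ^ ((d : ℝ) / 2) / ((2 * π) ^ d * 4 ^ m * m.factorial * Gamma (m + (d : ℝ) / 2)) *
    y ^ (2 * m) * (τ ^ (-((d : ℝ) + 2 * m) / (2 * p / q)) * (1 / (2 * p / q)) *
      Gamma (((d : ℝ) + 2 * m) / (2 * p / q)))

/-- Splitting the index by its residue `i` modulo `p` turns the expansion into `p` hypergeometric
series. -/
theorem expansionTerm_eq {d p q : ℕ} (hd : 1 ≤ d) (hq : 0 < q) {τ : ℝ} (hτ : 0 < τ)
    (y : ℝ) {i : ℕ} (hi : i < p) (n : ℕ) :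
    expansionTerm d p q τ y (p * n + i) = prefactor d p q τ * (gammaFactor d p q τ y i *
      hypTerm (upperParams d p q i) (lowerParams d p i) (hypArg p q τ y) n) := by
  have hp : 0 < p := by omega
  have hp' : (p : ℝ) ≠ 0 := by positivity
  have hq' : (q : ℝ) ≠ 0 := by positivity
  have hd' : (0 : ℝ) < d := by positivity
  set a : ℝ := ((d : ℝ) + 2 * i) / (2 * p) with ha
  have hapos : 0 < a := by positivity
  have e1 := Gamma_nat_mul_add hq hapos n
  have e2 := factorial_mul_add hi n
  have e3 := Gamma_nat_mul_add hp hapos n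
  have hA : 0 < (ascPochhammer ℝ n).eval a := ascPochhammer_pos n a hapos
  set PA := (ascPochhammer ℝ n).eval a
  set PU := ∏ j ∈ Finset.Icc 1 (q - 1), (ascPochhammer ℝ n).eval (a + (j : ℝ) / q) with hPU
  set PL1 := ∏ j ∈ (Finset.range p).filter (fun j => i + 1 + j ≠ p),
        (ascPochhammer ℝ n).eval (((i : ℝ) + 1 + j) / p) with hPL1
  set PL2 := ∏ j ∈ Finset.Icc 1 (p - 1), (ascPochhammer ℝ n).eval (a + (j : ℝ) / p) with hPL2
  have hL1 : 0 < PL1 := Finset.prod_pos fun j _ => ascPochhammer_pos n _ (by positivity)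
  have hL2 : 0 < PL2 := Finset.prod_pos fun j _ => ascPochhammer_pos n _ (by positivity)
  have hhyp : hypTerm (upperParams d p q i) (lowerParams d p i) (hypArg p q τ y) n =
      PU / (PL1 * PL2) * (hypArg p q τ y ^ n / n.factorial) := by
    rw [hypTerm, prod_map_upperParams, prod_map_lowerParams]
    congr 3
    refine Finset.prod_congr rfl fun j _ => ?_
    congr 1
    rw [ha]
    field_simp
  set T := τ ^ ((q : ℝ) / p) with hT
  have hTpos : 0 < T := by positivity
  have hτpow : τ ^ (-((d : ℝ) + 2 * (p * n + i : ℕ)) / (2 * p / q))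
      = τ ^ (-(d : ℝ) / (2 * p / q)) / T ^ (p * n + i) := by
    rw [hT, ← rpow_natCast, ← rpow_mul hτ.le, ← rpow_sub hτ]
    congr 1
    field_simp
    ring
  have hpow : zVar p q τ y ^ i * (zVar p q τ y ^ p) ^ n
      = (-1) ^ (p * n + i) * y ^ (2 * (p * n + i)) / (4 ^ (p * n + i) * T ^ (p * n + i)) := by
    rw [← pow_mul, ← pow_add, add_comm i, pow_mul y, ← mul_pow, ← mul_pow, ← div_pow]
    congr 1
    simp only [zVar, ← hT]
    field_simp
    norm_num
  have g1 : ((d : ℝ) + 2 * (p * n + i : ℕ)) / (2 * p / q) = q * a + (q * n : ℕ) := by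
    rw [ha]; push_cast; field_simp; ring
  have g2 : ((p * n + i : ℕ) : ℝ) + (d : ℝ) / 2 = p * a + (p * n : ℕ) := by
    rw [ha]; push_cast; field_simp; ring
  have g3 : ((d : ℝ) + 2 * i) / (2 * p / q) = q * a := by
    rw [ha]; field_simp
  have hS : unitSphereArea (d + 2 * i) = 2 * (π ^ ((d : ℝ) / 2) * π ^ i) / Gamma (p * a) := by
    rw [unitSphereArea_eq (by omega), ← rpow_natCast π i, ← rpow_add pi_pos]
    congr 2
    · congr 2; push_cast; ring
    · rw [ha]; push_cast; field_simp
  have hG1 : 0 < Gamma (p * a) := Gamma_pos_of_pos (by positivity)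
  have hG2 : 0 < Gamma (q * a) := Gamma_pos_of_pos (by positivity)
  have hqa : (d : ℝ) + 2 * i = 2 * p * a := by rw [ha]; field_simp
  unfold expansionTerm prefactor gammaFactor
  rw [hhyp, hτpow, g1, e1, g2, e3, e2, g3, hS, Gamma_add_one (by positivity), hqa]
  have harg : hypArg p q τ y ^ n
      = (zVar p q τ y ^ p) ^ n * (q : ℝ) ^ (q * n) / (p : ℝ) ^ (2 * p * n) := by
    rw [hypArg, div_pow, mul_pow, ← pow_mul (q : ℝ), ← pow_mul (p : ℝ)]
  rw [harg]
  have key : zVar p q τ y ^ i * (zVar p q τ y ^ p) ^ n * (4 ^ (p * n + i) * T ^ (p * n + i))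
      = (-1) ^ (p * n + i) * y ^ (2 * (p * n + i)) := by
    rw [hpow]; field_simp
  have hF1 : (0 : ℝ) < n.factorial := by positivity
  have hF2 : (0 : ℝ) < i.factorial := by positivity
  rw [show ∀ A B C E : ℝ, (-1) ^ (p * n + i) * A * B / C * y ^ (2 * (p * n + i)) * E
      = ((-1) ^ (p * n + i) * y ^ (2 * (p * n + i))) * (A * B / C * E) by intros; ring, ← key]
  field_simp
  ring

/-! ### Convergence and divergence of the hypergeometric series -/

theorem sum_range_mul_eq_sum_residues (f : ℕ → ℝ) (p N : ℕ) :
    ∑ m ∈ Finset.range (p * N), f m =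
      ∑ i ∈ Finset.range p, ∑ n ∈ Finset.range N, f (p * n + i) := by
  rw [Finset.sum_comm]
  induction N with
  | zero => simp
  | succ N ih => rw [mul_add, mul_one, Finset.sum_range_add, ih, Finset.sum_range_succ _ N]

theorem pureFormulaTrunc_eq_sum {d p q : ℕ} (hd : 1 ≤ d) (hq : 0 < q) {τ : ℝ} (hτ : 0 < τ)
    (y : ℝ) (N : ℕ) :
    pureFormulaTrunc d p q τ y N = ∑ m ∈ Finset.range (p * N), expansionTerm d p q τ y m := by
  rw [sum_range_mul_eq_sum_residues, pureFormulaTrunc, Finset.mul_sum]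
  refine Finset.sum_congr rfl fun i hi => ?_
  rw [Finset.mul_sum, Finset.mul_sum]
  exact Finset.sum_congr rfl fun n _ =>
    (expansionTerm_eq hd hq hτ y (Finset.mem_range.1 hi) n).symm

theorem hypTerm_succ (a b : Multiset ℝ) (w : ℝ) (n : ℕ) :
    hypTerm a b w (n + 1) = (a.map fun c => c + (n : ℝ)).prod /
      (b.map fun c => c + (n : ℝ)).prod *
      (w / (n + 1)) * hypTerm a b w n := by
  simp only [hypTerm, ascPochhammer_succ_eval, Multiset.prod_map_mul, pow_succ,
    Nat.factorial_succ, Nat.cast_mul, Nat.cast_succ]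
  simp only [div_eq_mul_inv, mul_inv]
  ring

theorem tendsto_prod_add_div_pow (a : Multiset ℝ) :
    Tendsto (fun n : ℕ => (a.map fun c => c + (n : ℝ)).prod / (n : ℝ) ^ a.card) atTop (𝓝 1) := by
  induction a using Multiset.induction with
  | empty => simp
  | cons c a ih =>
    have h : Tendsto (fun n : ℕ => c / (n : ℝ) + 1) atTop (𝓝 1) := by
      simpa using (tendsto_const_div_atTop_nhds_zero_nat c).add_const 1
    rw [show (1 : ℝ) = 1 * 1 by norm_num]
    refine (h.mul ih).congr' ?_
    filter_upwards [eventually_gt_atTop 0] with n hn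
    have hn' : (n : ℝ) ≠ 0 := by positivity
    simp only [Multiset.map_cons, Multiset.prod_cons, Multiset.card_cons, pow_succ]
    field_simp

/-- The quotient of consecutive terms of `_rF_s` is asymptotic to `n^{r-s-1} w`. -/
theorem hypTerm_succ_eq_tendsto (a b : Multiset ℝ) (w : ℝ) :
    ∃ R : ℕ → ℝ, Tendsto R atTop (𝓝 1) ∧ ∀ᶠ n : ℕ in atTop, hypTerm a b w (n + 1) =
      R n * ((n : ℝ) ^ a.card / (n : ℝ) ^ (b.card + 1)) * w * hypTerm a b w n := by
  refine ⟨fun n => (a.map fun c => c + (n : ℝ)).prod / (n : ℝ) ^ a.card /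
    ((b.map fun c => c + (n : ℝ)).prod / (n : ℝ) ^ b.card) *
      ((n : ℝ) / (n + 1)), ?_, ?_⟩
  · simpa using ((tendsto_prod_add_div_pow a).div (tendsto_prod_add_div_pow b) one_ne_zero).mul
      (tendsto_natCast_div_add_atTop (1 : ℝ))
  · filter_upwards [eventually_gt_atTop 0] with n hn
    have hn' : (n : ℝ) ≠ 0 := by positivity
    rw [hypTerm_succ]
    field_simp
    ring

theorem hypTerm_summable {a b : Multiset ℝ} {w : ℝ}
    (h : a.card ≤ b.card ∨ (a.card = b.card + 1 ∧ |w| < 1)) : Summable (hypTerm a b w) := by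
  obtain ⟨R, hR, hRe⟩ := hypTerm_succ_eq_tendsto a b w
  obtain ⟨L, hL, hlim⟩ : ∃ L : ℝ, L < 1 ∧
      Tendsto (fun n : ℕ => |R n * ((n : ℝ) ^ a.card / (n : ℝ) ^ (b.card + 1)) * w|)
        atTop (𝓝 L) := by
    rcases h with h | ⟨h, hw⟩
    · refine ⟨|1 * 0 * w|, by simp, ((hR.mul ?_).mul_const w).abs⟩
      obtain ⟨k, hk⟩ := Nat.exists_eq_add_of_le h
      have h0 : Tendsto (fun n : ℕ => ((n : ℝ) ^ (k + 1))⁻¹) atTop (𝓝 0) :=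
        tendsto_inv_atTop_zero.comp
          ((tendsto_pow_atTop (Nat.succ_ne_zero k)).comp tendsto_natCast_atTop_atTop)
      refine h0.congr' ?_
      filter_upwards [eventually_gt_atTop 0] with n hn
      have hn' : (n : ℝ) ≠ 0 := by positivity
      rw [hk, show a.card + k + 1 = a.card + (k + 1) by ring, pow_add _ a.card]
      field_simp
    · refine ⟨|1 * 1 * w|, by simpa, ((hR.mul ?_).mul_const w).abs⟩
      refine tendsto_const_nhds.congr' ?_
      filter_upwards [eventually_gt_atTop 0] with n hn
      have hn' : (n : ℝ) ≠ 0 := by positivity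
      rw [h, div_self (by positivity)]
  obtain ⟨r, hr1, hr2⟩ := exists_between hL
  refine summable_of_ratio_norm_eventually_le hr2 ?_
  filter_upwards [hRe, hlim.eventually_lt_const hr1] with n h1 h2
  rw [h1, norm_mul, Real.norm_eq_abs]
  gcongr

/-- With at least two more upper than lower parameters the terms of the series eventually grow. -/
theorem hypTerm_not_tendsto {a b : Multiset ℝ} {w : ℝ} (ha : ∀ c ∈ a, 0 < c) (hb : ∀ c ∈ b, 0 < c)
    (hw : w ≠ 0) (h : b.card + 2 ≤ a.card) : ¬ Tendsto (hypTerm a b w) atTop (𝓝 0) := by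
  obtain ⟨R, hR, hRe⟩ := hypTerm_succ_eq_tendsto a b w
  have hlim : Tendsto (fun n : ℕ => |R n * ((n : ℝ) ^ a.card / (n : ℝ) ^ (b.card + 1)) * w|)
      atTop atTop := by
    obtain ⟨k, hk⟩ := Nat.exists_eq_add_of_le h
    have h0 : Tendsto (fun n : ℕ => (n : ℝ) ^ (k + 1)) atTop atTop :=
      (tendsto_pow_atTop (Nat.succ_ne_zero k)).comp tendsto_natCast_atTop_atTop
    have h1 := (h0.const_mul_atTop (abs_pos.2 hw)).atTop_mul_pos one_pos
      (by simpa using hR.abs)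
    refine h1.congr' ?_
    filter_upwards [eventually_gt_atTop 0] with n hn
    have hn' : (n : ℝ) ≠ 0 := by positivity
    rw [hk, show b.card + 2 + k = b.card + 1 + (k + 1) by ring, pow_add _ (b.card + 1) (k + 1),
      mul_div_cancel_left₀ _ (by positivity), abs_mul, abs_mul, abs_of_nonneg
        (by positivity : (0 : ℝ) ≤ (n : ℝ) ^ (k + 1))]
    ring
  have hne : ∀ n, hypTerm a b w n ≠ 0 := by
    intro n
    have hpos : ∀ s : Multiset ℝ, (∀ c ∈ s, 0 < c) →
        (s.map fun c => (ascPochhammer ℝ n).eval c).prod ≠ 0 := by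
      intro s hs
      refine Multiset.prod_ne_zero fun h0 => ?_
      obtain ⟨c, hc, hc0⟩ := Multiset.mem_map.1 h0
      exact (ascPochhammer_pos n c (hs c hc)).ne' hc0
    have := hpos a ha
    have := hpos b hb
    unfold hypTerm
    positivity
  intro htend
  obtain ⟨N, hN⟩ := eventually_atTop.1 (hRe.and (hlim.eventually_ge_atTop 1))
  have hmono : ∀ n, |hypTerm a b w N| ≤ |hypTerm a b w (N + n)| := by
    intro n
    induction n with
    | zero => simp
    | succ n ih =>
      obtain ⟨h1, h2⟩ := hN (N + n) (by omega)
      rw [← add_assoc, h1, abs_mul]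
      exact ih.trans (le_mul_of_one_le_left (abs_nonneg _) h2)
  have h1 : Tendsto (fun n => |hypTerm a b w (N + n)|) atTop (𝓝 |0|) :=
    (htend.comp (tendsto_add_atTop_nat N |>.congr fun n => add_comm n N)).abs
  have := ge_of_tendsto' h1 hmono
  rw [abs_zero] at this
  exact hne N (abs_nonpos_iff.1 this)

theorem card_upperParams (d p q i : ℕ) : (upperParams d p q i).card = q - 1 := by
  simp [upperParams, Multiset.bind_def, Multiset.pure_def]

theorem card_lowerParams (d : ℕ) {p i : ℕ} (hi : i < p) : (lowerParams d p i).card = 2 * p - 2 := by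
  have h : ((Finset.range p).filter fun j => i + 1 + j ≠ p).card = p - 1 := by
    have : (Finset.range p).filter (fun j => i + 1 + j ≠ p) =
        (Finset.range p).erase (p - 1 - i) := by
      ext j; simp; omega
    rw [this, Finset.card_erase_of_mem (by simp; omega), Finset.card_range]
  have : (lowerParams d p i).card =
      ((Finset.range p).filter fun j => i + 1 + j ≠ p).card + (Finset.Icc 1 (p - 1)).card := by
    simp [lowerParams, Multiset.bind_def, Multiset.pure_def]
    rfl
  rw [this, h, Nat.card_Icc]
  omega

theorem upperParams_pos {d p q i : ℕ} (hd : 1 ≤ d) (hp : 0 < p) :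
    ∀ c ∈ upperParams d p q i, 0 < c := by
  have hd' : (0 : ℝ) < d := by positivity
  simp only [upperParams, Multiset.bind_def, Multiset.pure_def, Multiset.mem_map,
    Multiset.mem_bind, Multiset.mem_singleton]
  rintro c ⟨x, ⟨j, _, rfl⟩, rfl⟩
  positivity

theorem lowerParams_pos {d p i : ℕ} (hd : 1 ≤ d) (hp : 0 < p) : ∀ c ∈ lowerParams d p i, 0 < c := by
  have hd' : (0 : ℝ) < d := by positivity
  simp only [lowerParams, Multiset.bind_def, Multiset.pure_def, Multiset.mem_map,
    Multiset.mem_bind, Multiset.mem_singleton, Multiset.mem_add]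
  rintro c (⟨x, ⟨j, _, rfl⟩, rfl⟩ | ⟨x, ⟨j, _, rfl⟩, rfl⟩) <;> positivity

theorem hypTerm_params_not_convergent {d p q i : ℕ} (hd : 1 ≤ d) (hpq : 2 * p < q) (hi : i < p)
    {τ y : ℝ} (hτ : 0 < τ) (hy : 0 < y) :
    ¬ ∃ L : ℝ, Tendsto (fun N => ∑ n ∈ Finset.range N,
        hypTerm (upperParams d p q i) (lowerParams d p i) (hypArg p q τ y) n) atTop (𝓝 L) := by
  have hp : 0 < p := by omega
  have hq : 0 < q := by omega
  rintro ⟨L, hL⟩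
  refine hypTerm_not_tendsto (w := hypArg p q τ y) (upperParams_pos hd hp (q := q) (i := i))
    (lowerParams_pos hd hp (i := i)) ?_ ?_ ?_
  · have hT : τ ^ ((q : ℝ) / p) ≠ 0 := (rpow_pos_of_pos hτ _).ne'
    have hz : zVar p q τ y ≠ 0 := by
      unfold zVar
      exact div_ne_zero (neg_ne_zero.2 (by positivity)) hT
    unfold hypArg
    positivity
  · rw [card_upperParams, card_lowerParams d hi]; omega
  · have := (hL.comp (tendsto_add_atTop_nat 1)).sub hL
    rw [sub_self] at this
    refine this.congr fun n => ?_
    simp [Finset.sum_range_succ]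

theorem hypTerm_params_summable {d p q i : ℕ} (hp : 0 < p) (hi : i < p) {τ y : ℝ} (hτ : 0 < τ)
    (hy : 0 ≤ y) (h : q < 2 * p ∨ (q = 2 * p ∧ y < τ) ∨ y = 0) :
    Summable (hypTerm (upperParams d p q i) (lowerParams d p i) (hypArg p q τ y)) := by
  rcases h with h | ⟨rfl, hyt⟩ | rfl
  · refine hypTerm_summable (Or.inl ?_)
    rw [card_upperParams, card_lowerParams d hi]; omega
  · refine hypTerm_summable (Or.inr ⟨?_, ?_⟩)
    · rw [card_upperParams, card_lowerParams d hi]; omega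
    · have hp' : (p : ℝ) ≠ 0 := by positivity
      have e : hypArg p (2 * p) τ y = (-1) ^ p * (y / τ) ^ (2 * p) := by
        have h2 : ((2 * p : ℕ) : ℝ) / p = (2 : ℕ) := by push_cast; field_simp
        rw [hypArg, zVar, h2, rpow_natCast, pow_mul (y / τ), ← mul_pow, pow_mul ((2 * p : ℕ) : ℝ),
          pow_mul (p : ℝ), ← mul_pow, ← div_pow]
        congr 1
        push_cast
        field_simp
      rw [e, abs_mul, abs_pow, abs_pow, abs_neg, abs_one, one_pow, one_mul,
        abs_of_nonneg (by positivity)]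
      exact pow_lt_one₀ (by positivity) ((div_lt_one hτ).2 hyt) (by omega)
  · have e : hypArg p q τ 0 = 0 := by simp [hypArg, zVar, hp.ne']
    rw [e]
    refine summable_of_ne_finset_zero (s := {0}) fun n hn => ?_
    have : n ≠ 0 := by simpa using hn
    simp [hypTerm, this]

/-! ### Polar coordinates and the moments of the sphere -/

section Sphere

variable {E : Type*} [NormedAddCommGroup E] [InnerProductSpace ℝ E] [FiniteDimensional ℝ E]
  [MeasurableSpace E] [BorelSpace E]

/-- Polar coordinates for functions that need not be radial. -/
theorem integral_polar [Nontrivial E] (μ : Measure E) [μ.IsAddHaarMeasure] {f : E → ℝ}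
    (hf : Integrable f μ) :
    IntegrableOn (fun r : ℝ => r ^ (Module.finrank ℝ E - 1) *
      ∫ ω : Metric.sphere (0 : E) 1, f (r • (ω : E)) ∂μ.toSphere) (Ioi 0) ∧
    ∫ x, f x ∂μ = ∫ r in Ioi (0 : ℝ), r ^ (Module.finrank ℝ E - 1) *
      ∫ ω : Metric.sphere (0 : E) 1, f (r • (ω : E)) ∂μ.toSphere := by
  set d := Module.finrank ℝ E with hd
  have hmp := μ.measurePreserving_homeomorphUnitSphereProd
  rw [← hd] at hmp
  set g : Metric.sphere (0 : E) 1 × Ioi (0 : ℝ) → ℝ := fun z => f (z.2.1 • (z.1 : E)) with hg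
  have hgf : ∀ x : ({(0 : E)}ᶜ : Set E), g (homeomorphUnitSphereProd E x) = f x := by
    intro x
    have hx : ‖(x : E)‖ ≠ 0 := norm_ne_zero_iff.2 x.2
    simp [hg, smul_smul, hx]
  have hgi : Integrable g (μ.toSphere.prod (.volumeIoiPow (d - 1))) := by
    rw [← hmp.integrable_comp_emb (Homeomorph.measurableEmbedding _)]
    have h1 : IntegrableOn f ({(0 : E)}ᶜ) μ := hf.integrableOn
    rw [integrableOn_iff_comap_subtypeVal (measurableSet_singleton _).compl] at h1
    exact h1.congr (.of_forall fun x => (hgf x).symm)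
  have hint : ∫ x, f x ∂μ =
      ∫ r, ∫ ω, g (ω, r) ∂μ.toSphere ∂(.volumeIoiPow (d - 1) : Measure (Ioi (0 : ℝ))) := by
    rw [← integral_prod_symm _ hgi, ← hmp.integral_comp (Homeomorph.measurableEmbedding _)]
    simp_rw [hgf]
    rw [integral_subtype_comap (measurableSet_singleton _).compl f, restrict_compl_singleton]
  have hmeas : Measurable fun r : Ioi (0 : ℝ) => Real.toNNReal (r.1 ^ (d - 1)) :=
    (measurable_subtype_coe.pow_const _).real_toNNReal
  constructor
  · have h1 := hgi.integral_prod_right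
    rw [Measure.volumeIoiPow] at h1
    simp only [ENNReal.ofReal] at h1
    rw [integrable_withDensity_iff_integrable_smul hmeas] at h1
    rw [integrableOn_iff_comap_subtypeVal measurableSet_Ioi]
    refine h1.congr (.of_forall fun r => ?_)
    simp only [Function.comp, NNReal.smul_def, smul_eq_mul, hg]
    rw [Real.coe_toNNReal _ (pow_nonneg r.2.out.le _)]
  · rw [hint]
    simp only [Measure.volumeIoiPow, ENNReal.ofReal]
    rw [integral_withDensity_eq_integral_smul hmeas, ← integral_subtype_comap measurableSet_Ioi]
    refine integral_congr_ae (.of_forall fun r => ?_)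
    simp only [NNReal.smul_def, smul_eq_mul, hg]
    rw [Real.coe_toNNReal _ (pow_nonneg r.2.out.le _)]

theorem integrable_pow_mul_exp_neg_sq (n : ℕ) : Integrable fun x : ℝ => x ^ n * exp (-x ^ 2) := by
  have := integrable_rpow_mul_exp_neg_mul_sq (b := 1) one_pos (s := n)
    (by have : (0 : ℝ) ≤ n := n.cast_nonneg; linarith)
  simpa using this

theorem integral_Ioi_pow_mul_exp_neg_sq (n : ℕ) :
    ∫ x in Ioi (0 : ℝ), x ^ n * exp (-x ^ 2) = Gamma (((n : ℝ) + 1) / 2) / 2 := by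
  have := integral_rpow_mul_exp_neg_rpow (p := 2) (q := n) two_pos
    (by have : (0 : ℝ) ≤ n := n.cast_nonneg; linarith)
  rw [show Gamma (((n : ℝ) + 1) / 2) / 2 = 1 / 2 * Gamma (((n : ℝ) + 1) / 2) by ring, ← this]
  simp

theorem integral_pow_mul_exp_neg_sq (m : ℕ) :
    ∫ x : ℝ, x ^ (2 * m) * exp (-x ^ 2) = Gamma (m + 1 / 2) := by
  have h := integral_comp_abs (f := fun x : ℝ => x ^ (2 * m) * exp (-x ^ 2))
  rw [integral_Ioi_pow_mul_exp_neg_sq] at h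
  simp only [pow_mul, sq_abs] at h ⊢
  rw [h]
  push_cast
  rw [mul_div_cancel₀ _ two_ne_zero]
  congr 1
  ring

/-- The Gaussian moment splits into one-dimensional integrals in an orthonormal basis that starts
with the direction of `v`. -/
theorem integral_inner_pow_mul_gaussian [Nontrivial E] (m : ℕ) (v : E) :
    Integrable (fun x : E => ⟪x, v⟫ ^ (2 * m) * exp (-‖x‖ ^ 2)) ∧
    ∫ x : E, ⟪x, v⟫ ^ (2 * m) * exp (-‖x‖ ^ 2) =
      ‖v‖ ^ (2 * m) * (Gamma (m + 1 / 2) * π ^ (((Module.finrank ℝ E : ℝ) - 1) / 2)) := by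
  obtain ⟨k, hk⟩ : ∃ k, Module.finrank ℝ E = k + 1 :=
    ⟨Module.finrank ℝ E - 1, by have := Module.finrank_pos (R := ℝ) (M := E); omega⟩
  -- an orthonormal basis whose first vector is parallel to `v`
  obtain ⟨e, he, hve⟩ : ∃ e : E, ‖e‖ = 1 ∧ v = ‖v‖ • e := by
    by_cases hv : v = 0
    · obtain ⟨e, he⟩ := exists_norm_eq E zero_le_one
      exact ⟨e, he, by simp [hv]⟩
    · have : ‖v‖ ≠ 0 := norm_ne_zero_iff.2 hv
      exact ⟨‖v‖⁻¹ • v, by rw [norm_smul, norm_inv, norm_norm, inv_mul_cancel₀ this],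
        by simp [smul_smul, this]⟩
  obtain ⟨B, hB⟩ := Orthonormal.exists_orthonormalBasis_extension_of_card_eq
    (𝕜 := ℝ) (E := E) (ι := Fin (k + 1)) (by simpa using hk) (v := fun _ => e) (s := {0})
    (by
      constructor
      · rintro ⟨i, hi⟩; simpa using he
      · rintro ⟨i, hi⟩ ⟨j, hj⟩ hij
        exact absurd (Subtype.ext (hi.trans hj.symm)) hij)
  have hB0 : B 0 = e := hB 0 rfl
  set h : Fin (k + 1) → ℝ → ℝ := fun i x => (if i = 0 then x ^ (2 * m) else 1) * exp (-x ^ 2)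
    with hh
  have hhi : ∀ i, Integrable (h i) := by
    intro i
    by_cases hi : i = 0
    · simpa [h, hi] using integrable_pow_mul_exp_neg_sq (2 * m)
    · simpa [h, hi] using integrable_pow_mul_exp_neg_sq 0
  set T : E ≃ᵐ (Fin (k + 1) → ℝ) :=
    B.measurableEquiv.trans (MeasurableEquiv.toLp 2 (Fin (k + 1) → ℝ)).symm with hT
  have hmp : MeasurePreserving T :=
    B.measurePreserving_measurableEquiv.trans
      (EuclideanSpace.volume_preserving_symm_measurableEquiv_toLp (Fin (k + 1)))
  have hTi : ∀ x i, T x i = ⟪B i, x⟫ := fun x i => B.repr_apply_apply x i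
  have hfun : (fun x : E => ⟪x, v⟫ ^ (2 * m) * exp (-‖x‖ ^ 2)) =
      fun x => ‖v‖ ^ (2 * m) * ∏ i, h i (T x i) := by
    ext x
    have h1 : ⟪x, v⟫ = ‖v‖ * T x 0 := by
      rw [hTi, hB0, real_inner_comm]
      conv_lhs => rw [hve, real_inner_smul_left]
    have h2 : ‖x‖ ^ 2 = ∑ i, T x i ^ 2 := by
      rw [← B.sum_sq_norm_inner_right x]
      simp [hTi]
    rw [h1, h2, hh]
    simp only [Finset.prod_mul_distrib, Finset.prod_ite_eq', Finset.mem_univ, if_true]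
    rw [← exp_sum, Finset.sum_neg_distrib, mul_pow, mul_assoc]
  have hint : Integrable fun y : Fin (k + 1) → ℝ => ∏ i, h i (y i) := Integrable.fintype_prod hhi
  rw [hfun]
  refine ⟨((hmp.integrable_comp_emb T.measurableEmbedding).2 hint).const_mul _, ?_⟩
  rw [integral_const_mul, hmp.integral_comp' (g := fun y : Fin (k + 1) → ℝ => ∏ i, h i (y i)),
    integral_fintype_prod_volume_eq_prod, Fin.prod_univ_succ]
  have h0 : ∫ x, h 0 x = Gamma (m + 1 / 2) := by
    rw [← integral_pow_mul_exp_neg_sq]; simp [hh]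
  have hs : ∀ i : Fin k, ∫ x, h i.succ x = π ^ (1 / 2 : ℝ) := by
    intro i
    have := integral_pow_mul_exp_neg_sq 0
    simp only [mul_zero, pow_zero, Nat.cast_zero, zero_add, Gamma_one_half_eq] at this
    rw [← sqrt_eq_rpow, ← this]
    simp [hh]
  simp_rw [h0, hs]
  rw [Finset.prod_const, Finset.card_univ, Fintype.card_fin, ← rpow_natCast (π ^ (1 / 2 : ℝ)) k,
    ← rpow_mul pi_pos.le, hk]
  congr 3
  push_cast
  ring

theorem Gamma_natCast_add_half (m : ℕ) :
    Gamma ((m : ℝ) + 1 / 2) = (2 * m).factorial * √π / (4 ^ m * m.factorial) := by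
  induction m with
  | zero => simpa using Gamma_one_half_eq
  | succ m ih =>
    rw [show ((m + 1 : ℕ) : ℝ) + 1 / 2 = ((m : ℝ) + 1 / 2) + 1 by push_cast; ring,
      Gamma_add_one (by positivity), ih, show 2 * (m + 1) = 2 * m + 1 + 1 by ring,
      Nat.factorial_succ, Nat.factorial_succ, Nat.factorial_succ, pow_succ]
    push_cast
    field_simp
    ring

/-- The coefficient of `(-1)^m ‖v‖^{2m}` in the power series of `v ↦ ∫_{S^{d-1}} cos ⟨ω, v⟩ dω`. -/
noncomputable def sphereCoeff (d m : ℕ) : ℝ :=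
  2 * π ^ ((d : ℝ) / 2) / (4 ^ m * m.factorial * Gamma (m + (d : ℝ) / 2))

theorem sphereCoeff_pos {d : ℕ} (hd : 0 < d) (m : ℕ) : 0 < sphereCoeff d m := by
  have := Gamma_pos_of_pos (show 0 < (m : ℝ) + (d : ℝ) / 2 by positivity)
  unfold sphereCoeff
  positivity

/-- The even moments of the uniform measure of the sphere, from those of the Gaussian. -/
theorem integral_sphere_inner_pow [Nontrivial E] (m : ℕ) (v : E) :
    ∫ ω : Metric.sphere (0 : E) 1, ⟪(ω : E), v⟫ ^ (2 * m) ∂(volume : Measure E).toSphere =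
      (2 * m).factorial * sphereCoeff (Module.finrank ℝ E) m * ‖v‖ ^ (2 * m) := by
  obtain ⟨hi, he⟩ := integral_inner_pow_mul_gaussian m v
  have hp := (integral_polar volume hi).2
  set d := Module.finrank ℝ E with hd
  have hd0 : 0 < d := Module.finrank_pos
  set A := ∫ ω : Metric.sphere (0 : E) 1, ⟪(ω : E), v⟫ ^ (2 * m) ∂(volume : Measure E).toSphere
    with hA
  have h1 : ∀ r ∈ Ioi (0 : ℝ), r ^ (d - 1) * ∫ ω : Metric.sphere (0 : E) 1,
      ⟪r • (ω : E), v⟫ ^ (2 * m) * exp (-‖r • (ω : E)‖ ^ 2) ∂(volume : Measure E).toSphere =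
        A * (r ^ (d - 1 + 2 * m) * exp (-r ^ 2)) := by
    intro r hr
    have : ∀ ω : Metric.sphere (0 : E) 1, ⟪r • (ω : E), v⟫ ^ (2 * m) * exp (-‖r • (ω : E)‖ ^ 2)
        = ⟪(ω : E), v⟫ ^ (2 * m) * (r ^ (2 * m) * exp (-r ^ 2)) := by
      intro ω
      rw [real_inner_smul_left, norm_smul, norm_eq_of_mem_sphere, mul_one, norm_eq_abs, sq_abs]
      ring
    simp_rw [this]
    rw [integral_mul_const, pow_add]
    ring
  rw [he, setIntegral_congr_fun measurableSet_Ioi h1, integral_const_mul,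
    integral_Ioi_pow_mul_exp_neg_sq] at hp
  have hG : (((d - 1 + 2 * m : ℕ) : ℝ) + 1) / 2 = m + (d : ℝ) / 2 := by
    obtain ⟨k, hk⟩ : ∃ k, d = k + 1 := ⟨d - 1, by omega⟩
    rw [hk, Nat.add_sub_cancel]; push_cast; ring
  have hGpos := Gamma_pos_of_pos (show 0 < (m : ℝ) + (d : ℝ) / 2 by positivity)
  have hpi : √π * π ^ (((d : ℝ) - 1) / 2) = π ^ ((d : ℝ) / 2) := by
    rw [sqrt_eq_rpow, ← rpow_add pi_pos]; congr 1; ring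
  rw [hG, Gamma_natCast_add_half] at hp
  rw [sphereCoeff, ← hpi]
  field_simp at hp ⊢
  linarith

end Sphere

/-! ### Plane waves averaged over the sphere, and Bessel functions -/

theorem le_of_deriv_le_of_nonneg {f g f' g' : ℝ → ℝ} (hf : ∀ x, HasDerivAt f (f' x) x)
    (hg : ∀ x, HasDerivAt g (g' x) x) (h0 : f 0 = g 0) (h : ∀ x, 0 ≤ x → f' x ≤ g' x)
    {x : ℝ} (hx : 0 ≤ x) : f x ≤ g x := by
  have hmono : MonotoneOn (fun x => g x - f x) (Ici 0) := by
    refine monotoneOn_of_hasDerivWithinAt_nonneg (convex_Ici 0)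
      (f' := fun x => g' x - f' x) ?_ ?_ ?_
    · exact fun y _ => ((hg y).sub (hf y)).continuousAt.continuousWithinAt
    · exact fun y _ => ((hg y).sub (hf y)).hasDerivWithinAt
    · intro y hy
      rw [interior_Ici] at hy
      exact sub_nonneg.2 (h y hy.le)
  have := hmono (mem_Ici.2 le_rfl) (mem_Ici.2 hx) hx
  simp only [h0, sub_self] at this
  linarith

theorem abs_le_of_abs_deriv_le {f f' g g' : ℝ → ℝ} (hf : ∀ x, HasDerivAt f (f' x) x)
    (hg : ∀ x, HasDerivAt g (g' x) x) (hf0 : f 0 = 0) (hg0 : g 0 = 0)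
    (h : ∀ x, 0 ≤ x → |f' x| ≤ g' x) {x : ℝ} (hx : 0 ≤ x) : |f x| ≤ g x := by
  rw [abs_le]
  constructor
  · have := le_of_deriv_le_of_nonneg (fun x => (hf x).neg) hg (by simp [hf0, hg0])
      (fun x hx => (neg_le_abs _).trans (h x hx)) hx
    simp only [Pi.neg_apply] at this
    linarith
  · exact le_of_deriv_le_of_nonneg hf hg (by rw [hf0, hg0])
      (fun x hx => (le_abs_self _).trans (h x hx)) hx

theorem hasDerivAt_pow_succ_div_factorial (n : ℕ) (x : ℝ) :
    HasDerivAt (fun x : ℝ => x ^ (n + 1) / ((n + 1).factorial : ℝ))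
      (x ^ n / (n.factorial : ℝ)) x := by
  refine ((hasDerivAt_pow (n + 1) x).div_const _).congr_deriv ?_
  rw [Nat.factorial_succ]
  push_cast
  field_simp

/-- The error of a Taylor polynomial of the cosine is at most the first omitted term. -/
theorem abs_cos_sub_taylor_le (M : ℕ) (x : ℝ) :
    |cos x - ∑ m ∈ Finset.range M, (-1) ^ m * (x ^ (2 * m) / ((2 * m).factorial : ℝ))| ≤
      x ^ (2 * M) / ((2 * M).factorial : ℝ) := by
  -- the claim for the cosine and its analogue for the sine are proved together, by integration
  suffices H : ∀ M : ℕ, (∀ x : ℝ, 0 ≤ x →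
      |cos x - ∑ m ∈ Finset.range M, (-1) ^ m * (x ^ (2 * m) / ((2 * m).factorial : ℝ))| ≤
        x ^ (2 * M) / ((2 * M).factorial : ℝ)) ∧ ∀ x : ℝ, 0 ≤ x →
      |sin x - ∑ m ∈ Finset.range M, (-1) ^ m * (x ^ (2 * m + 1) / ((2 * m + 1).factorial : ℝ))| ≤
        x ^ (2 * M + 1) / ((2 * M + 1).factorial : ℝ) by
    have := (H M).1 |x| (abs_nonneg x)
    simpa only [cos_abs, pow_mul, sq_abs] using this
  intro M
  have hsin : ∀ M : ℕ, (∀ x : ℝ, 0 ≤ x →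
      |cos x - ∑ m ∈ Finset.range M, (-1) ^ m * (x ^ (2 * m) / ((2 * m).factorial : ℝ))| ≤
        x ^ (2 * M) / ((2 * M).factorial : ℝ)) → ∀ x : ℝ, 0 ≤ x →
      |sin x - ∑ m ∈ Finset.range M, (-1) ^ m * (x ^ (2 * m + 1) / ((2 * m + 1).factorial : ℝ))| ≤
        x ^ (2 * M + 1) / ((2 * M + 1).factorial : ℝ) := by
    intro M h x hx
    refine abs_le_of_abs_deriv_le (f := fun x => sin x - ∑ m ∈ Finset.range M, (-1) ^ m *
      (x ^ (2 * m + 1) / ((2 * m + 1).factorial : ℝ))) (fun y => (hasDerivAt_sin y).sub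
        (HasDerivAt.fun_sum fun m _ => (hasDerivAt_pow_succ_div_factorial (2 * m) y).const_mul _))
        (hasDerivAt_pow_succ_div_factorial (2 * M)) ?_ ?_ h hx
    · simp
    · simp
  induction M with
  | zero =>
    have h0 : ∀ x : ℝ, 0 ≤ x → |cos x - ∑ m ∈ Finset.range 0, (-1) ^ m *
        (x ^ (2 * m) / ((2 * m).factorial : ℝ))| ≤ x ^ (2 * 0) / ((2 * 0).factorial : ℝ) := by
      intro x _
      simpa using abs_cos_le_one x
    exact ⟨h0, hsin 0 h0⟩
  | succ M ih =>
    have h1 : ∀ x : ℝ, 0 ≤ x → |cos x - ∑ m ∈ Finset.range (M + 1), (-1) ^ m *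
        (x ^ (2 * m) / ((2 * m).factorial : ℝ))| ≤
          x ^ (2 * (M + 1)) / ((2 * (M + 1)).factorial : ℝ) := by
      intro x hx
      simp only [Finset.sum_range_succ', mul_zero, pow_zero, Nat.factorial_zero, Nat.cast_one,
        div_one, mul_one]
      refine abs_le_of_abs_deriv_le (f := fun x => cos x - (∑ m ∈ Finset.range M, (-1) ^ (m + 1) *
        (x ^ (2 * m + 1 + 1) / ((2 * m + 1 + 1).factorial : ℝ)) + 1))
        (fun y => (hasDerivAt_cos y).sub ((HasDerivAt.fun_sum fun m _ =>
          (hasDerivAt_pow_succ_div_factorial (2 * m + 1) y).const_mul _).add_const _))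
        (hasDerivAt_pow_succ_div_factorial (2 * M + 1)) ?_ ?_ (fun y hy => ?_) hx
      · simp
      · simp
      · rw [← abs_neg]
        convert ih.2 y hy using 2
        simp only [pow_succ, sub_neg_eq_add, mul_neg, mul_one, neg_mul,
          Finset.sum_neg_distrib]
        ring
    exact ⟨h1, hsin _ h1⟩

section Sphere

variable {E : Type*} [NormedAddCommGroup E] [InnerProductSpace ℝ E] [FiniteDimensional ℝ E]
  [MeasurableSpace E] [BorelSpace E]

/-- The integral of `cos ⟨ω, v⟩` over the unit sphere. -/
noncomputable def sphereCos (v : E) : ℝ :=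
  ∫ ω : Metric.sphere (0 : E) 1, cos ⟪(ω : E), v⟫ ∂(volume : Measure E).toSphere

theorem integrable_sphere_of_continuous {f : ℝ → ℝ} (hf : Continuous f) (v : E) :
    Integrable (fun ω : Metric.sphere (0 : E) 1 => f ⟪(ω : E), v⟫)
      (volume : Measure E).toSphere := by
  have hc : Continuous fun ω : Metric.sphere (0 : E) 1 => f ⟪(ω : E), v⟫ := by fun_prop
  exact hc.integrable_of_hasCompactSupport (HasCompactSupport.of_compactSpace _)

/-- The error of a partial sum of the power series of `sphereCos` is at most the first omitted
term. -/
theorem abs_sphereCos_sub_sum_le [Nontrivial E] (M : ℕ) (v : E) :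
    |sphereCos v - ∑ m ∈ Finset.range M,
      (-1) ^ m * (sphereCoeff (Module.finrank ℝ E) m * ‖v‖ ^ (2 * m))| ≤
        sphereCoeff (Module.finrank ℝ E) M * ‖v‖ ^ (2 * M) := by
  have hi := fun m : ℕ => integrable_sphere_of_continuous
    (f := fun x : ℝ => x ^ (2 * m) / ((2 * m).factorial : ℝ)) (by fun_prop) v
  have hval : ∀ m : ℕ, ∫ ω : Metric.sphere (0 : E) 1,
      ⟪(ω : E), v⟫ ^ (2 * m) / ((2 * m).factorial : ℝ) ∂(volume : Measure E).toSphere =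
        sphereCoeff (Module.finrank ℝ E) m * ‖v‖ ^ (2 * m) := by
    intro m
    rw [integral_div, integral_sphere_inner_pow]
    field_simp
  simp_rw [← hval, ← integral_const_mul]
  rw [← integral_finsetSum _ fun m _ => (hi m).const_mul _, sphereCos, ← integral_sub
    (integrable_sphere_of_continuous continuous_cos v)
    (integrable_finsetSum _ fun m _ => (hi m).const_mul _)]
  refine (abs_integral_le_integral_abs).trans (integral_mono_of_nonneg
    (.of_forall fun _ => abs_nonneg _) (hi M) (.of_forall fun ω => abs_cos_sub_taylor_le M _))

theorem besselTerm_eq_sphereCoeff {d : ℕ} {s : ℝ} (hs : 0 < s) (m : ℕ) :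
    (2 * π) ^ ((d : ℝ) / 2) * besselTerm (((d : ℝ) - 2) / 2) s m =
      s ^ (((d : ℝ) - 2) / 2) * ((-1) ^ m * (sphereCoeff d m * s ^ (2 * m))) := by
  have e1 : ((d : ℝ) - 2) / 2 + m + 1 = m + (d : ℝ) / 2 := by ring
  have e2 : (s / 2) ^ (((d : ℝ) - 2) / 2 + 2 * m) =
      s ^ (((d : ℝ) - 2) / 2) * s ^ (2 * m) / ((2 : ℝ) ^ ((d : ℝ) / 2) * 4 ^ m / 2) := by
    have : ((2 * m : ℕ) : ℝ) = 2 * m := by push_cast; ring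
    rw [← this, rpow_add (by positivity), rpow_natCast, div_rpow hs.le zero_le_two, div_pow,
      show ((d : ℝ) - 2) / 2 = (d : ℝ) / 2 - 1 by ring, rpow_sub_one (two_ne_zero), pow_mul 2]
    norm_num
    field_simp
  rw [besselTerm, sphereCoeff, e1, e2, mul_rpow zero_le_two pi_pos.le]
  field_simp

theorem summable_sphereCoeff_mul_pow {d : ℕ} (hd : 0 < d) (s : ℝ) :
    Summable fun m : ℕ => sphereCoeff d m * s ^ (2 * m) := by
  refine summable_of_ratio_norm_eventually_le (r := 1 / 2) (by norm_num) ?_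
  obtain ⟨N, hN⟩ := exists_nat_ge (s ^ 2)
  filter_upwards [eventually_ge_atTop (N + 1)] with m hm
  have hdR : (0 : ℝ) < d := by positivity
  have hm' : (N : ℝ) + 1 ≤ m := by exact_mod_cast hm
  have hN0 : (0 : ℝ) ≤ N := N.cast_nonneg
  have hmpos : 0 < (m : ℝ) + (d : ℝ) / 2 := by positivity
  have hG := Gamma_pos_of_pos hmpos
  have e : sphereCoeff d (m + 1) * s ^ (2 * (m + 1)) =
      s ^ 2 / (4 * (m + 1) * (m + (d : ℝ) / 2)) * (sphereCoeff d m * s ^ (2 * m)) := by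
    rw [sphereCoeff, sphereCoeff, show ((m + 1 : ℕ) : ℝ) + (d : ℝ) / 2 = (m + (d : ℝ) / 2) + 1 by
      push_cast; ring, Gamma_add_one hmpos.ne', Nat.factorial_succ, pow_succ 4, mul_add, pow_add s]
    push_cast
    field_simp
  rw [e, norm_mul]
  gcongr
  rw [norm_of_nonneg (by positivity), div_le_div_iff₀ (by positivity) (by positivity)]
  nlinarith

theorem sphereCos_eq_besselJ [Nontrivial E] {v : E} (hv : v ≠ 0) :
    ‖v‖ ^ (((Module.finrank ℝ E : ℝ) - 2) / 2) * sphereCos v =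
      (2 * π) ^ ((Module.finrank ℝ E : ℝ) / 2) *
        besselJ (((Module.finrank ℝ E : ℝ) - 2) / 2) ‖v‖ := by
  have hs : 0 < ‖v‖ := norm_pos_iff.2 hv
  have hsum := summable_sphereCoeff_mul_pow (Module.finrank_pos (R := ℝ) (M := E)) ‖v‖
  have hlim : HasSum (fun m : ℕ => (-1) ^ m *
      (sphereCoeff (Module.finrank ℝ E) m * ‖v‖ ^ (2 * m))) (sphereCos v) := by
    have hs2 : Summable fun m : ℕ => (-1) ^ m *
        (sphereCoeff (Module.finrank ℝ E) m * ‖v‖ ^ (2 * m)) := by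
      refine hsum.norm.of_norm_bounded fun m => ?_
      simp [norm_mul]
    have h0 : Tendsto (fun M => sphereCos v - ∑ m ∈ Finset.range M, (-1) ^ m *
      (sphereCoeff (Module.finrank ℝ E) m * ‖v‖ ^ (2 * m))) atTop (𝓝 0) :=
      squeeze_zero_norm (fun M => abs_sphereCos_sub_sum_le M v) hsum.tendsto_atTop_zero
    have h1 := h0.const_sub (sphereCos v)
    simp only [sub_sub_cancel, sub_zero] at h1
    exact (hs2.hasSum_iff_tendsto_nat).2 h1
  rw [besselJ, ← tsum_mul_left, ← hlim.tsum_eq, ← tsum_mul_left]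
  exact tsum_congr fun m => (besselTerm_eq_sphereCoeff hs m).symm

end Sphere

/-! ### The solution on the Fourier side -/

/-- A bound `‖A'‖ ≤ C s^k / k!` on `(0, t]` integrates to `‖A‖ ≤ C s^{k+1} / (k+1)!` if `A` vanishes
at `0+`. -/
theorem norm_le_pow_succ_div_factorial {A A' : ℝ → ℂ} {C : ℝ} {k : ℕ}
    (hA : ∀ s, 0 < s → HasDerivAt A (A' s) s) (h0 : Tendsto A (𝓝[>] 0) (𝓝 0))
    (hb : ∀ s, 0 < s → ‖A' s‖ ≤ C * (s ^ k / (k.factorial : ℝ))) {t : ℝ} (ht : 0 < t) :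
    ‖A t‖ ≤ C * (t ^ (k + 1) / ((k + 1).factorial : ℝ)) := by
  have hε : ∀ ε ∈ Ioo 0 t, ‖A t‖ ≤ ‖A ε‖ + (C * (t ^ (k + 1) / ((k + 1).factorial : ℝ)) -
      C * (ε ^ (k + 1) / ((k + 1).factorial : ℝ))) := by
    intro ε hε
    refine image_norm_le_of_norm_deriv_right_le_deriv_boundary (a := ε) (b := t)
      (f := A) (f' := A') (B := fun s => ‖A ε‖ + (C * (s ^ (k + 1) / ((k + 1).factorial : ℝ)) -
        C * (ε ^ (k + 1) / ((k + 1).factorial : ℝ))))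
      (B' := fun s => C * (s ^ k / (k.factorial : ℝ))) ?_ ?_ (by simp) ?_ ?_ ⟨hε.2.le, le_rfl⟩
    · exact fun s hs => (hA s (hε.1.trans_le hs.1)).continuousAt.continuousWithinAt
    · exact fun s hs => (hA s (hε.1.trans_le hs.1)).hasDerivWithinAt
    · exact fun s => (((hasDerivAt_pow_succ_div_factorial k s).const_mul C).sub_const _).const_add _
    · exact fun s hs => hb s (hε.1.trans_le hs.1)
  have hlim : Tendsto (fun ε : ℝ => ‖A ε‖ + (C * (t ^ (k + 1) / ((k + 1).factorial : ℝ)) -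
      C * (ε ^ (k + 1) / ((k + 1).factorial : ℝ)))) (𝓝[>] 0)
      (𝓝 (‖(0 : ℂ)‖ + (C * (t ^ (k + 1) / ((k + 1).factorial : ℝ)) -
        C * ((0 : ℝ) ^ (k + 1) / ((k + 1).factorial : ℝ))))) := by
    refine h0.norm.add (tendsto_const_nhds.sub ?_)
    have : Continuous fun ε : ℝ => C * (ε ^ (k + 1) / ((k + 1).factorial : ℝ)) := by fun_prop
    exact (this.tendsto 0).mono_left nhdsWithin_le_nhds
  have := ge_of_tendsto hlim (by filter_upwards [Ioo_mem_nhdsGT ht] with ε h using hε ε h)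
  simpa using this

section Fourier

open scoped ContDiff

variable {d : ℕ}

/-- The Fourier symbol of `-b · ∇ - D_f (-Δ)^α` at the frequency `k = 2πξ`. -/
noncomputable def symbol (b : EuclideanSpace ℝ (Fin d)) (Df α : ℝ)
    (ξ : EuclideanSpace ℝ (Fin d)) : ℂ :=
  -(2 * π * Complex.I * ⟪ξ, b⟫) - Df * ((2 * π * ‖ξ‖) ^ (2 * α) : ℝ)

/-- The Fourier transform of the solution at time `t`. -/
noncomputable def symbolExp (b x₀ : EuclideanSpace ℝ (Fin d)) (Df α t : ℝ)
    (ξ : EuclideanSpace ℝ (Fin d)) : ℂ :=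
  Complex.exp (-(2 * π * Complex.I * ⟪ξ, x₀⟫) + t * symbol b Df α ξ)

theorem continuous_symbol (b : EuclideanSpace ℝ (Fin d)) (Df : ℝ) {α : ℝ} (hα : 0 < α) :
    Continuous (symbol b Df α) := by
  have : Continuous fun ξ : EuclideanSpace ℝ (Fin d) => (2 * π * ‖ξ‖) ^ (2 * α) :=
    Continuous.rpow_const (by fun_prop) fun _ => Or.inr (by positivity)
  unfold symbol
  fun_prop

theorem norm_symbolExp (b x₀ : EuclideanSpace ℝ (Fin d)) (Df α t : ℝ)
    (ξ : EuclideanSpace ℝ (Fin d)) :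
    ‖symbolExp b x₀ Df α t ξ‖ = exp (-(Df * t) * (2 * π * ‖ξ‖) ^ (2 * α)) := by
  rw [symbolExp, Complex.norm_exp, symbol]
  congr 1
  simp [Complex.add_re, Complex.mul_re]
  ring

/-- Smooth functions with compact support in the complement of the origin, where the symbol is
smooth. -/
structure IsPuncturedTest (φ : EuclideanSpace ℝ (Fin d) → ℂ) : Prop where
  contDiff : ContDiff ℝ ∞ φ
  hasCompactSupport : HasCompactSupport φ
  zero_notMem : (0 : EuclideanSpace ℝ (Fin d)) ∉ tsupport φ

theorem IsPuncturedTest.mul_of_contDiffAt {φ m : EuclideanSpace ℝ (Fin d) → ℂ}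
    (hφ : IsPuncturedTest φ) (hm : ∀ ξ ≠ 0, ContDiffAt ℝ ∞ m ξ) :
    IsPuncturedTest fun ξ => m ξ * φ ξ := by
  have hsub : tsupport (fun ξ => m ξ * φ ξ) ⊆ tsupport φ :=
    closure_mono (Function.support_mul_subset_right _ _)
  refine ⟨contDiff_iff_contDiffAt.2 fun ξ => ?_, hφ.hasCompactSupport.mul_left,
    fun h => hφ.zero_notMem (hsub h)⟩
  by_cases hξ : ξ ∈ tsupport φ
  · have hξ' : ξ ≠ 0 := by
      rintro rfl
      exact hφ.zero_notMem hξ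
    exact (hm ξ hξ').mul hφ.contDiff.contDiffAt
  · refine contDiffAt_const (c := (0 : ℂ)) |>.congr_of_eventuallyEq ?_
    filter_upwards [notMem_tsupport_iff_eventuallyEq.1 hξ] with η hη
    simp [hη]

theorem contDiffAt_rpow_norm (α : ℝ) {ξ : EuclideanSpace ℝ (Fin d)} (hξ : ξ ≠ 0) :
    ContDiffAt ℝ ∞ (fun ξ => (((2 * π * ‖ξ‖) ^ (2 * α) : ℝ) : ℂ)) ξ := by
  have h1 : ContDiffAt ℝ ∞ (fun ξ : EuclideanSpace ℝ (Fin d) => 2 * π * ‖ξ‖) ξ :=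
    contDiffAt_const.mul (contDiffAt_norm ℝ hξ)
  have h2 := h1.rpow_const_of_ne (p := 2 * α) (by have := norm_pos_iff.2 hξ; positivity)
  exact Complex.ofRealCLM.contDiff.contDiffAt.comp ξ h2

theorem contDiff_ofReal_inner (b : EuclideanSpace ℝ (Fin d)) :
    ContDiff ℝ ∞ (fun ξ => ((⟪ξ, b⟫ : ℝ) : ℂ)) :=
  Complex.ofRealCLM.contDiff.comp (contDiff_id.inner ℝ contDiff_const)

theorem contDiffAt_symbol (b : EuclideanSpace ℝ (Fin d)) (Df α : ℝ)
    {ξ : EuclideanSpace ℝ (Fin d)} (hξ : ξ ≠ 0) : ContDiffAt ℝ ∞ (symbol b Df α) ξ :=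
  (contDiffAt_const.mul (contDiff_ofReal_inner b).contDiffAt).neg.sub
    (contDiffAt_const.mul (contDiffAt_rpow_norm α hξ))

theorem IsPuncturedTest.symbol_mul {φ : EuclideanSpace ℝ (Fin d) → ℂ} (hφ : IsPuncturedTest φ)
    (b : EuclideanSpace ℝ (Fin d)) (Df α : ℝ) : IsPuncturedTest fun ξ => symbol b Df α ξ * φ ξ :=
  hφ.mul_of_contDiffAt fun _ => contDiffAt_symbol b Df α

theorem IsPuncturedTest.integrable {φ : EuclideanSpace ℝ (Fin d) → ℂ} (hφ : IsPuncturedTest φ) :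
    Integrable φ :=
  hφ.contDiff.continuous.integrable_of_hasCompactSupport hφ.hasCompactSupport

/-- A test function on the frequency side, as a Schwartz function. -/
noncomputable def IsPuncturedTest.toSchwartz {φ : EuclideanSpace ℝ (Fin d) → ℂ}
    (hφ : IsPuncturedTest φ) : 𝓢(EuclideanSpace ℝ (Fin d), ℂ) :=
  hφ.hasCompactSupport.toSchwartzMap hφ.contDiff

/-- The Fourier transform is self-adjoint for the bilinear pairing. -/
theorem integral_mul_fourier_eq {f g : EuclideanSpace ℝ (Fin d) → ℂ} (hf : Integrable f)
    (hg : Integrable g) : ∫ x, f x * 𝓕 g x = ∫ ξ, 𝓕 f ξ * g ξ := by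
  simpa using! (VectorFourier.integral_fourierIntegral_smul_eq_flip (L := innerₗ _)
      Real.continuous_fourierChar continuous_inner hf hg).symm

theorem fderiv_fourier_apply {φ : EuclideanSpace ℝ (Fin d) → ℂ} (hφ : IsPuncturedTest φ)
    (b x : EuclideanSpace ℝ (Fin d)) :
    fderiv ℝ (𝓕 φ) x b = 𝓕 (fun ξ => -(2 * π * Complex.I * ⟪ξ, b⟫) * φ ξ) x := by
  have hi2 : Integrable fun v => ‖v‖ * ‖φ v‖ :=
    (by have := hφ.contDiff.continuous; fun_prop : Continuous fun v => ‖v‖ * ‖φ v‖)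
      |>.integrable_of_hasCompactSupport hφ.hasCompactSupport.norm.mul_left
  have hi : Integrable (VectorFourier.fourierSMulRight (innerSL ℝ) φ) := by
    refine (hi2.const_mul (2 * π * ‖innerSL ℝ (E := EuclideanSpace ℝ (Fin d))‖)).mono'
      hφ.integrable.aestronglyMeasurable.fourierSMulRight (.of_forall fun v => ?_)
    exact (VectorFourier.norm_fourierSMulRight_le _ _ _).trans_eq (by ring)
  rw [Real.fderiv_fourier hφ.integrable hi2, fourier_continuousLinearMap_apply hi]
  refine congrArg (fun g : EuclideanSpace ℝ (Fin d) → ℂ => 𝓕 g x) (funext fun ξ => ?_)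
  simp [VectorFourier.fourierSMulRight_apply, innerSL_apply_apply ℝ]
  ring

theorem IsPuncturedTest.fourierInv_fourier {φ : EuclideanSpace ℝ (Fin d) → ℂ}
    (hφ : IsPuncturedTest φ) : 𝓕⁻ (𝓕 φ) = φ :=
  hφ.contDiff.continuous.fourierInv_fourier_eq hφ.integrable (𝓕 hφ.toSchwartz).integrable

/-- The fractional Laplacian of a Fourier transform `𝓕 φ` is the Fourier transform of `φ` times the
symbol; it need not be a Schwartz function unless `φ` vanishes near the origin. -/
theorem fracLaplacian_fourier {φ : EuclideanSpace ℝ (Fin d) → ℂ} (hφ : IsPuncturedTest φ)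
    (α : ℝ) (f : 𝓢(EuclideanSpace ℝ (Fin d), ℂ))
    (hf : (f : EuclideanSpace ℝ (Fin d) → ℂ) = 𝓕 φ) :
    fracLaplacian α f = 𝓕 (fun ξ => (((2 * π * ‖ξ‖) ^ (2 * α) : ℝ) : ℂ) * φ ξ) := by
  have h2 : ∀ ξ, 𝓕 (f : EuclideanSpace ℝ (Fin d) → ℂ) ξ = φ (-ξ) := by
    intro ξ
    rw [hf, ← congr_fun hφ.fourierInv_fourier, fourierInv_eq_fourier_neg, neg_neg]
  ext x
  rw [fracLaplacian, fourierInv_eq_fourier_comp_neg]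
  simp [h2]

theorem fourier_sub_const_mul {f g : EuclideanSpace ℝ (Fin d) → ℂ} (hf : Integrable f)
    (hg : Integrable g) (c : ℂ) (x : EuclideanSpace ℝ (Fin d)) :
    𝓕 (fun ξ => f ξ - c * g ξ) x = 𝓕 f x - c * 𝓕 g x := by
  simp only [Real.fourier_eq, ← integral_const_mul]
  rw [← integral_sub]
  · congr 1
    refine funext fun ξ => ?_
    simp only [Circle.smul_def, smul_eq_mul]
    ring
  · exact (Real.fourierIntegral_convergent_iff x).2 hf
  · exact ((Real.fourierIntegral_convergent_iff x).2 hg).const_mul c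

variable {b x₀ : EuclideanSpace ℝ (Fin d)} {Df α : ℝ} {u : EuclideanSpace ℝ (Fin d) → ℝ → ℝ}

/-- The equation on the Fourier side: multiplication by the symbol. -/
theorem IsFundamentalSolution.hasDerivAt_fourier (hu : IsFundamentalSolution b x₀ 0 Df α u)
    {φ : EuclideanSpace ℝ (Fin d) → ℂ} (hφ : IsPuncturedTest φ) {t : ℝ} (ht : 0 < t) :
    HasDerivAt (fun s => ∫ ξ, 𝓕 (fun x => (u x s : ℂ)) ξ * φ ξ)
      (∫ ξ, 𝓕 (fun x => (u x t : ℂ)) ξ * (symbol b Df α ξ * φ ξ)) t := by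
  have h := hu.equation (𝓕 hφ.toSchwartz) t ht
  have hcoe : ((𝓕 hφ.toSchwartz : 𝓢(EuclideanSpace ℝ (Fin d), ℂ)) :
      EuclideanSpace ℝ (Fin d) → ℂ) = 𝓕 φ := rfl
  have hφ1 := hφ.mul_of_contDiffAt (m := fun ξ => -(2 * π * Complex.I * ⟪ξ, b⟫))
    fun ξ _ => (contDiffAt_const.mul (contDiff_ofReal_inner b).contDiffAt).neg
  have hφ2 := hφ.mul_of_contDiffAt fun ξ hξ => contDiffAt_rpow_norm α hξ
  have hval : ∀ x, fderiv ℝ (𝓕 hφ.toSchwartz : 𝓢(EuclideanSpace ℝ (Fin d), ℂ)) x b +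
      ((0 : ℝ) : ℂ) * Laplacian.laplacian ((𝓕 hφ.toSchwartz :
        𝓢(EuclideanSpace ℝ (Fin d), ℂ)) : EuclideanSpace ℝ (Fin d) → ℂ) x -
        (Df : ℂ) * fracLaplacian α (𝓕 hφ.toSchwartz) x =
      𝓕 (fun ξ => symbol b Df α ξ * φ ξ) x := by
    intro x
    rw [fracLaplacian_fourier hφ α _ hcoe, hcoe, fderiv_fourier_apply hφ, Complex.ofReal_zero,
      zero_mul, add_zero, ← fourier_sub_const_mul hφ1.integrable hφ2.integrable]
    refine congrArg (fun g : EuclideanSpace ℝ (Fin d) → ℂ => 𝓕 g x) (funext fun ξ => ?_)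
    simp only [symbol]
    ring
  simp_rw [hval] at h
  have hi : ∀ s, 0 < s → Integrable fun x => (u x s : ℂ) := fun s hs => (hu.integrable s hs).ofReal
  rw [← integral_mul_fourier_eq (hi t ht) (hφ.symbol_mul b Df α).integrable]
  refine h.congr_of_eventuallyEq ?_
  filter_upwards [Ioi_mem_nhds ht] with s hs
  rw [hcoe, integral_mul_fourier_eq (hi s hs) hφ.integrable]

theorem IsFundamentalSolution.tendsto_fourier (hu : IsFundamentalSolution b x₀ 0 Df α u)
    {φ : EuclideanSpace ℝ (Fin d) → ℂ} (hφ : IsPuncturedTest φ) :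
    Tendsto (fun s => ∫ ξ, 𝓕 (fun x => (u x s : ℂ)) ξ * φ ξ) (𝓝[>] 0) (𝓝 (𝓕 φ x₀)) := by
  refine (hu.initial (𝓕 hφ.toSchwartz)).congr' ?_
  filter_upwards [self_mem_nhdsWithin] with s hs
  exact integral_mul_fourier_eq (hu.integrable s hs).ofReal hφ.integrable

theorem continuous_symbolExp (b x₀ : EuclideanSpace ℝ (Fin d)) (Df t : ℝ) (hα : 0 < α) :
    Continuous (symbolExp b x₀ Df α t) := by
  have := continuous_symbol b Df hα
  unfold symbolExp
  fun_prop

theorem norm_symbolExp_le_one (hDf : 0 < Df) {t : ℝ} (ht : 0 < t) (ξ : EuclideanSpace ℝ (Fin d)) :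
    ‖symbolExp b x₀ Df α t ξ‖ ≤ 1 := by
  rw [norm_symbolExp, exp_le_one_iff, neg_mul, neg_nonpos]
  positivity

theorem hasDerivAt_integral_symbolExp (hDf : 0 < Df) (hα : 0 < α)
    {φ : EuclideanSpace ℝ (Fin d) → ℂ} (hφ : IsPuncturedTest φ) {t : ℝ} (ht : 0 < t) :
    HasDerivAt (fun s => ∫ ξ, symbolExp b x₀ Df α s ξ * φ ξ)
      (∫ ξ, symbolExp b x₀ Df α t ξ * (symbol b Df α ξ * φ ξ)) t := by
  have hc := hφ.contDiff.continuous
  have hcs := continuous_symbol b Df hα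
  have hce := fun s => continuous_symbolExp b x₀ Df s hα
  refine (hasDerivAt_integral_of_dominated_loc_of_deriv_le (s := Ioi 0) (Ioi_mem_nhds ht)
    (bound := fun ξ => ‖symbol b Df α ξ * φ ξ‖)
    (F' := fun s ξ => symbolExp b x₀ Df α s ξ * (symbol b Df α ξ * φ ξ))
    (.of_forall fun s => ?_) ?_ ?_ (.of_forall fun ξ s hs => ?_)
    (hφ.symbol_mul b Df α).integrable.norm (.of_forall fun ξ s hs => ?_)).2
  · have := hce s
    exact (by fun_prop : Continuous fun ξ => symbolExp b x₀ Df α s ξ * φ ξ).aestronglyMeasurable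
  · exact hφ.integrable.bdd_mul (c := 1) (hce t).aestronglyMeasurable
      (.of_forall fun ξ => norm_symbolExp_le_one hDf ht ξ)
  · have := hce t
    exact (by fun_prop : Continuous fun ξ => symbolExp b x₀ Df α t ξ *
      (symbol b Df α ξ * φ ξ)).aestronglyMeasurable
  · rw [norm_mul]
    exact mul_le_of_le_one_left (norm_nonneg _) (norm_symbolExp_le_one hDf hs ξ)
  · have h1 : HasDerivAt (fun s : ℝ => -(2 * π * Complex.I * ⟪ξ, x₀⟫) + s * symbol b Df α ξ)
        (symbol b Df α ξ) s := by
      simpa using ((Complex.ofRealCLM.hasDerivAt (x := s)).mul_const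
        (symbol b Df α ξ)).const_add (-(2 * π * Complex.I * ⟪ξ, x₀⟫))
    simpa only [symbolExp, mul_assoc] using (h1.cexp.mul_const (φ ξ))

theorem tendsto_integral_symbolExp (hDf : 0 < Df) (hα : 0 < α)
    {φ : EuclideanSpace ℝ (Fin d) → ℂ} (hφ : IsPuncturedTest φ) :
    Tendsto (fun s => ∫ ξ, symbolExp b x₀ Df α s ξ * φ ξ) (𝓝[>] 0) (𝓝 (𝓕 φ x₀)) := by
  have hc := hφ.contDiff.continuous
  have h0 : 𝓕 φ x₀ = ∫ ξ, symbolExp b x₀ Df α 0 ξ * φ ξ := by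
    rw [Real.fourier_eq']
    refine integral_congr_ae (.of_forall fun ξ => ?_)
    simp only [symbolExp, smul_eq_mul]
    congr 2
    push_cast
    ring
  rw [h0]
  refine tendsto_integral_filter_of_dominated_convergence (fun ξ => ‖φ ξ‖) ?_ ?_
    hφ.integrable.norm (.of_forall fun ξ => ?_)
  · refine .of_forall fun s => ?_
    have := continuous_symbolExp b x₀ Df s hα
    exact (by fun_prop : Continuous fun ξ => symbolExp b x₀ Df α s ξ * φ ξ).aestronglyMeasurable
  · filter_upwards [self_mem_nhdsWithin] with s hs
    refine .of_forall fun ξ => ?_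
    rw [norm_mul]
    exact mul_le_of_le_one_left (norm_nonneg _) (norm_symbolExp_le_one hDf hs ξ)
  · have : Continuous fun s : ℝ => symbolExp b x₀ Df α s ξ * φ ξ := by
      unfold symbolExp
      fun_prop
    exact (this.tendsto 0).mono_left nhdsWithin_le_nhds

theorem IsFundamentalSolution.norm_fourier_le (hu : IsFundamentalSolution b x₀ 0 Df α u) {t : ℝ}
    (ht : 0 < t) (ξ : EuclideanSpace ℝ (Fin d)) : ‖𝓕 (fun x => (u x t : ℂ)) ξ‖ ≤ 1 := by
  refine (VectorFourier.norm_fourierIntegral_le_integral_norm _ _ _ _ _).trans_eq ?_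
  rw [← hu.integral_eq_one t ht]
  refine integral_congr_ae (.of_forall fun x => ?_)
  simp [abs_of_nonneg (hu.nonneg t ht x)]

theorem IsFundamentalSolution.continuous_fourier (hu : IsFundamentalSolution b x₀ 0 Df α u) {t : ℝ}
    (ht : 0 < t) : Continuous (𝓕 (fun x => (u x t : ℂ))) :=
  VectorFourier.fourierIntegral_continuous Real.continuous_fourierChar
    (by exact continuous_inner) (hu.integrable t ht).ofReal

/-- Uniqueness on the Fourier side. The pairing of `û - symbolExp` with a test function `φ` has
derivative the pairing with `symbol * φ`, vanishes at time `0`, and is at most twice the `L¹` norm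
of `φ`; iterating, it is bounded by `2 ‖symbolᵏ φ‖₁ tᵏ / k!`, which tends to `0`. -/
theorem IsFundamentalSolution.integral_sub_mul_eq_zero (hu : IsFundamentalSolution b x₀ 0 Df α u)
    (hDf : 0 < Df) (hα : 0 < α) {φ : EuclideanSpace ℝ (Fin d) → ℂ} (hφ : IsPuncturedTest φ)
    {t : ℝ} (ht : 0 < t) :
    ∫ ξ, (𝓕 (fun x => (u x t : ℂ)) ξ - symbolExp b x₀ Df α t ξ) * φ ξ = 0 := by
  set A : (EuclideanSpace ℝ (Fin d) → ℂ) → ℝ → ℂ := fun φ s =>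
    (∫ ξ, 𝓕 (fun x => (u x s : ℂ)) ξ * φ ξ) - ∫ ξ, symbolExp b x₀ Df α s ξ * φ ξ with hA
  have hi1 : ∀ {φ}, IsPuncturedTest φ → ∀ s, 0 < s →
      Integrable fun ξ => 𝓕 (fun x => (u x s : ℂ)) ξ * φ ξ := fun hφ s hs =>
    hφ.integrable.bdd_mul (c := 1) (hu.continuous_fourier hs).aestronglyMeasurable
      (.of_forall fun ξ => hu.norm_fourier_le hs ξ)
  have hi2 : ∀ {φ}, IsPuncturedTest φ → ∀ s, 0 < s →
      Integrable fun ξ => symbolExp b x₀ Df α s ξ * φ ξ := fun hφ s hs =>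
    hφ.integrable.bdd_mul (c := 1) (continuous_symbolExp b x₀ Df s hα).aestronglyMeasurable
      (.of_forall fun ξ => norm_symbolExp_le_one hDf hs ξ)
  have hbound : ∀ k : ℕ, ∀ φ, IsPuncturedTest φ → ∀ s, 0 < s →
      ‖A φ s‖ ≤ 2 * (∫ ξ, ‖symbol b Df α ξ ^ k * φ ξ‖) * (s ^ k / (k.factorial : ℝ)) := by
    intro k
    induction k with
    | zero =>
      intro φ hφ s hs
      have h1 : ‖∫ ξ, 𝓕 (fun x => (u x s : ℂ)) ξ * φ ξ‖ ≤ ∫ ξ, ‖φ ξ‖ :=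
        norm_integral_le_of_norm_le hφ.integrable.norm (.of_forall fun ξ => by
          rw [norm_mul]; exact mul_le_of_le_one_left (norm_nonneg _) (hu.norm_fourier_le hs ξ))
      have h2 : ‖∫ ξ, symbolExp b x₀ Df α s ξ * φ ξ‖ ≤ ∫ ξ, ‖φ ξ‖ :=
        norm_integral_le_of_norm_le hφ.integrable.norm (.of_forall fun ξ => by
          rw [norm_mul]
          exact mul_le_of_le_one_left (norm_nonneg _) (norm_symbolExp_le_one hDf hs ξ))
      have := norm_sub_le (∫ ξ, 𝓕 (fun x => (u x s : ℂ)) ξ * φ ξ)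
        (∫ ξ, symbolExp b x₀ Df α s ξ * φ ξ)
      simp only [hA, pow_zero, one_mul, Nat.factorial_zero, Nat.cast_one, div_one, mul_one]
      linarith
    | succ k ih =>
      intro φ hφ s hs
      refine norm_le_pow_succ_div_factorial (A := A φ)
        (A' := A fun ξ => symbol b Df α ξ * φ ξ) (fun r hr => ?_) ?_ (fun r hr => ?_) hs
      · exact (hu.hasDerivAt_fourier hφ hr).sub (hasDerivAt_integral_symbolExp hDf hα hφ hr)
      · simpa using (hu.tendsto_fourier hφ).sub
          (tendsto_integral_symbolExp (b := b) (x₀ := x₀) hDf hα hφ)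
      · have := ih _ (hφ.symbol_mul b Df α) r hr
        simpa only [pow_succ, mul_assoc] using this
  have hAt : A φ t = 0 := by
    -- the symbol is bounded on the support of `φ`
    obtain ⟨C, hC⟩ := hφ.hasCompactSupport.isCompact.exists_bound_of_continuousOn
      (continuous_symbol b Df hα).continuousOn
    set M := max C 0
    have hM : ∀ k : ℕ, ‖A φ t‖ ≤ 2 * (∫ ξ, ‖φ ξ‖) * ((M * t) ^ k / (k.factorial : ℝ)) := by
      intro k
      have h1 : ∫ ξ, ‖symbol b Df α ξ ^ k * φ ξ‖ ≤ M ^ k * ∫ ξ, ‖φ ξ‖ := by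
        rw [← integral_const_mul]
        refine integral_mono_of_nonneg (.of_forall fun _ => norm_nonneg _)
          (hφ.integrable.norm.const_mul _) (.of_forall fun ξ => ?_)
        by_cases hξ : ξ ∈ tsupport φ
        · simp only [norm_mul, norm_pow]
          gcongr
          exact (hC ξ hξ).trans (le_max_left _ _)
        · simp [image_eq_zero_of_notMem_tsupport hξ]
      refine (hbound k φ hφ t ht).trans ?_
      calc _ ≤ 2 * (M ^ k * ∫ ξ, ‖φ ξ‖) * (t ^ k / (k.factorial : ℝ)) := by gcongr
        _ = _ := by rw [mul_pow]; ring
    have h0 : Tendsto (fun k : ℕ => 2 * (∫ ξ, ‖φ ξ‖) * ((M * t) ^ k / (k.factorial : ℝ))) atTop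
        (𝓝 0) := by
      simpa using (FloorSemiring.tendsto_pow_div_factorial_atTop (M * t)).const_mul
        (2 * ∫ ξ, ‖φ ξ‖)
    exact norm_le_zero_iff.1 (ge_of_tendsto' h0 hM)
  simp_rw [sub_mul]
  rw [integral_sub (hi1 hφ t ht) (hi2 hφ t ht)]
  exact hAt

theorem IsFundamentalSolution.fourier_ae_eq (hu : IsFundamentalSolution b x₀ 0 Df α u) (hd : 0 < d)
    (hDf : 0 < Df) (hα : 0 < α) {t : ℝ} (ht : 0 < t) :
    𝓕 (fun x => (u x t : ℂ)) =ᵐ[volume] symbolExp b x₀ Df α t := by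
  have : Nonempty (Fin d) := ⟨⟨0, hd⟩⟩
  have hc : Continuous fun ξ => 𝓕 (fun x => (u x t : ℂ)) ξ - symbolExp b x₀ Df α t ξ :=
    (hu.continuous_fourier ht).sub (continuous_symbolExp b x₀ Df t hα)
  have h := IsOpen.ae_eq_zero_of_integral_contDiff_smul_eq_zero (μ := volume)
    (isOpen_compl_singleton (x := (0 : EuclideanSpace ℝ (Fin d))))
    (hc.locallyIntegrable.locallyIntegrableOn _) fun g hg hgc hgs => by
      have hφ : IsPuncturedTest fun ξ => (g ξ : ℂ) := by
        have hsub : tsupport (fun ξ => (g ξ : ℂ)) ⊆ tsupport g :=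
          closure_mono fun ξ hξ => by simpa using hξ
        exact ⟨Complex.ofRealCLM.contDiff.comp hg, hgc.comp_left Complex.ofReal_zero,
          fun h => hgs (hsub h) rfl⟩
      rw [← hu.integral_sub_mul_eq_zero hDf hα hφ ht]
      refine integral_congr_ae (.of_forall fun ξ => ?_)
      simp only [Complex.real_smul]
      ring
  have h0 : ∀ᵐ ξ : EuclideanSpace ℝ (Fin d), ξ ≠ 0 := Measure.ae_ne volume 0
  filter_upwards [h, h0] with ξ h1 h2
  exact sub_eq_zero.1 (h1 h2)

end Fourier

/-! ### The integral representation and its expansion -/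

theorem integrableOn_radial_moment {τ β : ℝ} (hτ : 0 < τ) (hβ : 0 < β) (k : ℕ) :
    IntegrableOn (fun r : ℝ => r ^ k * exp (-τ * r ^ β)) (Ioi 0) := by
  simpa using integrableOn_rpow_mul_exp_neg_mul_rpow (s := k)
    (by have : (0 : ℝ) ≤ k := k.cast_nonneg; linarith) hβ hτ

section Representation

variable {d : ℕ} {b x₀ : EuclideanSpace ℝ (Fin d)} {Df α : ℝ}
  {u : EuclideanSpace ℝ (Fin d) → ℝ → ℝ}

theorem integrable_exp_neg_mul_norm_rpow (hd : 0 < d) {τ β : ℝ} (hτ : 0 < τ) (hβ : 0 < β) :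
    Integrable fun ξ : EuclideanSpace ℝ (Fin d) => exp (-τ * ‖ξ‖ ^ β) := by
  have : Nonempty (Fin d) := ⟨⟨0, hd⟩⟩
  refine (integrable_fun_norm_addHaar volume (f := fun r : ℝ => exp (-τ * r ^ β))).2 ?_
  simpa only [smul_eq_mul] using integrableOn_radial_moment hτ hβ _

/-- The solution is the inverse Fourier transform of `exp (-D_f t |k|^{2α})`, centred at
`x₀ + t b`. -/
theorem IsFundamentalSolution.eq_integral_cexp (hu : IsFundamentalSolution b x₀ 0 Df α u)
    (hd : 0 < d) (hDf : 0 < Df) (hα : 0 < α) {t : ℝ} (ht : 0 < t)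
    (x : EuclideanSpace ℝ (Fin d)) :
    (u x t : ℂ) = ((2 * π) ^ d : ℂ)⁻¹ * ∫ ξ : EuclideanSpace ℝ (Fin d),
      Complex.exp (⟪ξ, x - x₀ - t • b⟫ * Complex.I) *
        (exp (-(Df * t) * ‖ξ‖ ^ (2 * α)) : ℝ) := by
  have hae := hu.fourier_ae_eq hd hDf hα ht
  have hdil : Integrable fun ξ : EuclideanSpace ℝ (Fin d) =>
      exp (-(Df * t) * (2 * π * ‖ξ‖) ^ (2 * α)) := by
    have := (integrable_comp_smul_iff (μ := volume) (fun ξ : EuclideanSpace ℝ (Fin d) =>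
      exp (-(Df * t) * ‖ξ‖ ^ (2 * α))) (R := 2 * π) (by positivity)).2
      (integrable_exp_neg_mul_norm_rpow hd (by positivity) (by positivity))
    simpa [norm_smul, abs_of_pos pi_pos] using this
  have hint : Integrable (symbolExp b x₀ Df α t) := by
    refine hdil.mono' (continuous_symbolExp b x₀ Df t hα).aestronglyMeasurable
      (.of_forall fun ξ => (norm_symbolExp b x₀ Df α t ξ).le)
  have hinv := congr_fun
    ((Complex.continuous_ofReal.comp (hu.continuous t ht)).fourierInv_fourier_eq
    (hu.integrable t ht).ofReal (hint.congr hae.symm)) x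
  have h1 : (u x t : ℂ) = ∫ ξ, (fun ζ : EuclideanSpace ℝ (Fin d) =>
      Complex.exp (⟪ζ, x - x₀ - t • b⟫ * Complex.I) *
        (exp (-(Df * t) * ‖ζ‖ ^ (2 * α)) : ℝ)) ((2 * π) • ξ) := by
    refine hinv.symm.trans ?_
    refine (Real.fourierInv_congr_ae hae x).trans ?_
    rw [Real.fourierInv_eq']
    refine integral_congr_ae (.of_forall fun ξ => ?_)
    simp only [symbolExp, symbol, smul_eq_mul, norm_smul, inner_sub_right, real_inner_smul_left,
      real_inner_smul_right, Complex.ofReal_exp]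
    rw [← Complex.exp_add, ← Complex.exp_add, norm_of_nonneg (by positivity : 0 ≤ 2 * π)]
    congr 1
    push_cast
    ring
  rw [h1, Measure.integral_comp_smul volume (fun ζ : EuclideanSpace ℝ (Fin d) =>
    Complex.exp (⟪ζ, x - x₀ - t • b⟫ * Complex.I) *
      (exp (-(Df * t) * ‖ζ‖ ^ (2 * α)) : ℝ)) (2 * π), finrank_euclideanSpace_fin,
    abs_of_pos (by positivity), Complex.real_smul]
  push_cast
  rfl

theorem integrable_cos_mul_exp (hd : 0 < d) {τ β : ℝ} (hτ : 0 < τ) (hβ : 0 < β)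
    (X : EuclideanSpace ℝ (Fin d)) : Integrable fun ξ : EuclideanSpace ℝ (Fin d) =>
      cos ⟪ξ, X⟫ * exp (-τ * ‖ξ‖ ^ β) :=
  (integrable_exp_neg_mul_norm_rpow hd hτ hβ).bdd_mul (c := 1)
    (by fun_prop : Continuous fun ξ : EuclideanSpace ℝ (Fin d) => cos ⟪ξ, X⟫).aestronglyMeasurable
    (.of_forall fun ξ => abs_cos_le_one _)

/-- The representation in polar coordinates, the angular integral being `sphereCos`. -/
theorem IsFundamentalSolution.eq_integral_sphereCos (hu : IsFundamentalSolution b x₀ 0 Df α u)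
    (hd : 0 < d) (hDf : 0 < Df) (hα : 0 < α) {t : ℝ} (ht : 0 < t)
    (x : EuclideanSpace ℝ (Fin d)) :
    IntegrableOn (fun r : ℝ => r ^ (d - 1) * exp (-(Df * t) * r ^ (2 * α)) *
      sphereCos (r • (x - x₀ - t • b))) (Ioi 0) ∧
    u x t = ((2 * π) ^ d)⁻¹ * ∫ r in Ioi (0 : ℝ), r ^ (d - 1) *
      exp (-(Df * t) * r ^ (2 * α)) * sphereCos (r • (x - x₀ - t • b)) := by
  have : Nonempty (Fin d) := ⟨⟨0, hd⟩⟩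
  have hτ : 0 < Df * t := by positivity
  set X := x - x₀ - t • b with hX
  have hci := integrable_cos_mul_exp hd hτ (by positivity : 0 < 2 * α) X
  have hre : u x t = ((2 * π) ^ d)⁻¹ * ∫ ξ : EuclideanSpace ℝ (Fin d),
      cos ⟪ξ, X⟫ * exp (-(Df * t) * ‖ξ‖ ^ (2 * α)) := by
    have hi : Integrable fun ξ : EuclideanSpace ℝ (Fin d) =>
        Complex.exp (⟪ξ, X⟫ * Complex.I) * (exp (-(Df * t) * ‖ξ‖ ^ (2 * α)) : ℝ) := by
      refine (integrable_exp_neg_mul_norm_rpow hd hτ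
        (by positivity : 0 < 2 * α)).ofReal.bdd_mul (c := 1) ?_ ?_
      · exact (by fun_prop : Continuous fun ξ : EuclideanSpace ℝ (Fin d) =>
          Complex.exp (⟪ξ, X⟫ * Complex.I)).aestronglyMeasurable
      · exact .of_forall fun ξ => (Complex.norm_exp_ofReal_mul_I _).le
    have h := congrArg Complex.re (hu.eq_integral_cexp hd hDf hα ht x)
    rw [show ((2 * π) ^ d : ℂ)⁻¹ = ((((2 * π) ^ d)⁻¹ : ℝ) : ℂ) by push_cast; rfl,
      Complex.re_ofReal_mul, Complex.ofReal_re] at h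
    rw [h, ← hX]
    congr 1
    refine (Complex.reCLM.integral_comp_comm hi).symm.trans ?_
    refine integral_congr_ae (.of_forall fun ξ => ?_)
    simp only [Complex.reCLM_apply, Complex.re_mul_ofReal, Complex.exp_ofReal_mul_I_re]
  have hpol := integral_polar volume hci
  rw [finrank_euclideanSpace_fin] at hpol
  have hin : ∀ r ∈ Ioi (0 : ℝ), r ^ (d - 1) * ∫ ω : Metric.sphere (0 : EuclideanSpace ℝ (Fin d)) 1,
      cos ⟪r • (ω : EuclideanSpace ℝ (Fin d)), X⟫ *
        exp (-(Df * t) * ‖r • (ω : EuclideanSpace ℝ (Fin d))‖ ^ (2 * α))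
          ∂(volume : Measure (EuclideanSpace ℝ (Fin d))).toSphere =
      r ^ (d - 1) * exp (-(Df * t) * r ^ (2 * α)) * sphereCos (r • X) := by
    intro r hr
    simp only [norm_smul, norm_eq_of_mem_sphere, mul_one, norm_of_nonneg (le_of_lt hr),
      real_inner_smul_left, integral_mul_const, sphereCos, real_inner_smul_right]
    ring
  refine ⟨hpol.1.congr_fun hin measurableSet_Ioi, ?_⟩
  rw [hre, hpol.2, setIntegral_congr_fun measurableSet_Ioi hin]

end Representation

section Expansion

variable {d p q : ℕ}

theorem integral_expansionTerm (hd : 0 < d) (hp : 0 < p) (hq : 0 < q) {τ : ℝ} (hτ : 0 < τ)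
    (y : ℝ) (m : ℕ) :
    IntegrableOn (fun r : ℝ => r ^ (d - 1) * exp (-τ * r ^ (2 * ((p : ℝ) / q))) *
      ((-1) ^ m * (sphereCoeff d m * (y * r) ^ (2 * m)))) (Ioi 0) ∧
    ((2 * π) ^ d)⁻¹ * ∫ r in Ioi (0 : ℝ), r ^ (d - 1) * exp (-τ * r ^ (2 * ((p : ℝ) / q))) *
      ((-1) ^ m * (sphereCoeff d m * (y * r) ^ (2 * m))) = expansionTerm d p q τ y m := by
  have hβ : 0 < 2 * ((p : ℝ) / q) := by positivity
  have hfun : (fun r : ℝ => r ^ (d - 1) * exp (-τ * r ^ (2 * ((p : ℝ) / q))) *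
      ((-1) ^ m * (sphereCoeff d m * (y * r) ^ (2 * m)))) = fun r : ℝ =>
      ((-1) ^ m * sphereCoeff d m * y ^ (2 * m)) *
        (r ^ (d - 1 + 2 * m) * exp (-τ * r ^ (2 * ((p : ℝ) / q)))) := by
    ext r
    rw [mul_pow, pow_add]
    ring
  rw [hfun]
  refine ⟨(integrableOn_radial_moment hτ hβ _).const_mul _, ?_⟩
  have hmom := integral_rpow_mul_exp_neg_mul_rpow (q := ((d - 1 + 2 * m : ℕ) : ℝ)) hβ
    (by have : (0 : ℝ) ≤ ((d - 1 + 2 * m : ℕ) : ℝ) := Nat.cast_nonneg _; linarith) hτ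
  simp only [rpow_natCast] at hmom
  have hdm : ((d - 1 + 2 * m : ℕ) : ℝ) + 1 = d + 2 * m := by
    obtain ⟨k, rfl⟩ : ∃ k, d = k + 1 := ⟨d - 1, by omega⟩
    rw [Nat.add_sub_cancel]; push_cast; ring
  rw [integral_const_mul, hmom, hdm, expansionTerm, sphereCoeff, mul_div_assoc]
  have hG := Gamma_pos_of_pos (show 0 < (m : ℝ) + (d : ℝ) / 2 by positivity)
  field_simp

variable {b x₀ : EuclideanSpace ℝ (Fin d)} {Df : ℝ} {u : EuclideanSpace ℝ (Fin d) → ℝ → ℝ}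

/-- The error of a partial sum of the expansion is at most the first omitted term. Both the
convergence for `α ≥ 1/2` and the asymptotic expansion for every `α` follow from this. -/
theorem IsFundamentalSolution.abs_sub_sum_expansionTerm_le
    (hu : IsFundamentalSolution b x₀ 0 Df ((p : ℝ) / q) u) (hd : 0 < d) (hp : 0 < p) (hq : 0 < q)
    (hDf : 0 < Df) {t : ℝ} (ht : 0 < t) (x : EuclideanSpace ℝ (Fin d)) (M : ℕ) :
    |u x t - ∑ m ∈ Finset.range M, expansionTerm d p q (Df * t) ‖x - x₀ - t • b‖ m| ≤
      |expansionTerm d p q (Df * t) ‖x - x₀ - t • b‖ M| := by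
  have : Nonempty (Fin d) := ⟨⟨0, hd⟩⟩
  have hτ : 0 < Df * t := by positivity
  obtain ⟨h1, h2⟩ := hu.eq_integral_sphereCos hd hDf (by positivity) ht x
  set X := x - x₀ - t • b
  have hE := integral_expansionTerm hd hp hq hτ ‖X‖
  have hE2 := fun m => (hE m).2
  rw [h2]
  simp_rw [← hE2]
  rw [← Finset.mul_sum, ← integral_finsetSum _ fun m _ => (hE m).1, ← mul_sub,
    ← integral_sub h1 (integrable_finsetSum _ fun m _ => (hE m).1), abs_mul, abs_mul]
  refine mul_le_mul_of_nonneg_left ?_ (abs_nonneg _)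
  have hc := (sphereCoeff_pos hd M).le
  have habs : |∫ r in Ioi (0 : ℝ), r ^ (d - 1) * exp (-(Df * t) * r ^ (2 * ((p : ℝ) / q))) *
      ((-1) ^ M * (sphereCoeff d M * (‖X‖ * r) ^ (2 * M)))| =
      ∫ r in Ioi (0 : ℝ), ‖r ^ (d - 1) * exp (-(Df * t) * r ^ (2 * ((p : ℝ) / q))) *
      ((-1) ^ M * (sphereCoeff d M * (‖X‖ * r) ^ (2 * M)))‖ := by
    have e1 : ∀ r ∈ Ioi (0 : ℝ), r ^ (d - 1) * exp (-(Df * t) * r ^ (2 * ((p : ℝ) / q))) *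
      ((-1) ^ M * (sphereCoeff d M * (‖X‖ * r) ^ (2 * M))) = (-1) ^ M *
        ‖r ^ (d - 1) * exp (-(Df * t) * r ^ (2 * ((p : ℝ) / q))) *
          ((-1) ^ M * (sphereCoeff d M * (‖X‖ * r) ^ (2 * M)))‖ := by
      intro r hr
      have hr' : (0 : ℝ) ≤ r := le_of_lt hr
      rw [norm_mul, norm_of_nonneg (by positivity), norm_mul, norm_pow, norm_neg, norm_one,
        one_pow, one_mul, norm_of_nonneg (by positivity)]
      ring
    rw [setIntegral_congr_fun measurableSet_Ioi e1, integral_const_mul, abs_mul, abs_pow, abs_neg,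
      abs_one, one_pow, one_mul, abs_of_nonneg (integral_nonneg fun _ => norm_nonneg _)]
  rw [habs, ← Real.norm_eq_abs]
  refine norm_integral_le_of_norm_le (hE M).1.norm ?_
  filter_upwards [ae_restrict_mem measurableSet_Ioi] with r hr
  have hr' : (0 : ℝ) ≤ r := le_of_lt hr
  rw [← Finset.mul_sum, ← mul_sub, norm_mul, norm_mul (_ * _) ((-1) ^ M * _)]
  refine mul_le_mul_of_nonneg_left ?_ (norm_nonneg _)
  have := abs_sphereCos_sub_sum_le M (r • X)
  rw [finrank_euclideanSpace_fin, norm_smul, norm_of_nonneg hr', mul_comm r] at this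
  refine this.trans (le_of_eq ?_)
  rw [norm_mul, norm_pow, norm_neg, norm_one, one_pow, one_mul, norm_of_nonneg (by positivity)]

theorem expansionTerm_eq_mul_pow (τ y : ℝ) (m : ℕ) :
    expansionTerm d p q τ y m = expansionTerm d p q τ 1 m * y ^ (2 * m) := by
  simp only [expansionTerm, one_pow]
  ring

theorem IsFundamentalSolution.isBigO_sub_pureFormulaTrunc
    (hu : IsFundamentalSolution b x₀ 0 Df ((p : ℝ) / q) u) (hd : 0 < d) (hp : 0 < p) (hq : 0 < q)
    (hDf : 0 < Df) {t : ℝ} (ht : 0 < t) (N : ℕ) :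
    (fun x => u x t - pureFormulaTrunc d p q (Df * t) ‖x - x₀ - t • b‖ N)
        =O[𝓝 (x₀ + t • b)] fun x => ‖x - x₀ - t • b‖ ^ (2 * p * N) := by
  refine IsBigO.of_bound |expansionTerm d p q (Df * t) 1 (p * N)| (.of_forall fun x => ?_)
  rw [pureFormulaTrunc_eq_sum hd hq (by positivity)]
  refine (hu.abs_sub_sum_expansionTerm_le hd hp hq hDf ht x _).trans (le_of_eq ?_)
  rw [expansionTerm_eq_mul_pow, abs_mul, mul_assoc 2 p N, Real.norm_eq_abs]

theorem IsFundamentalSolution.eq_pureFormula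
    (hu : IsFundamentalSolution b x₀ 0 Df ((p : ℝ) / q) u) (hd : 0 < d) (hp : 0 < p) (hq : 0 < q)
    (hDf : 0 < Df) {t : ℝ} (ht : 0 < t) (x : EuclideanSpace ℝ (Fin d))
    (h : q < 2 * p ∨ (q = 2 * p ∧ ‖x - x₀ - t • b‖ < Df * t) ∨ ‖x - x₀ - t • b‖ = 0) :
    (∀ i < p, Summable (hypTerm (upperParams d p q i) (lowerParams d p i)
      (hypArg p q (Df * t) ‖x - x₀ - t • b‖))) ∧
    u x t = pureFormula d p q (Df * t) ‖x - x₀ - t • b‖ := by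
  have hτ : 0 < Df * t := by positivity
  have hs := fun i (hi : i < p) => hypTerm_params_summable (d := d) hp hi hτ (norm_nonneg _) h
  refine ⟨hs, ?_⟩
  have h1 : Tendsto (fun N => pureFormulaTrunc d p q (Df * t) ‖x - x₀ - t • b‖ N) atTop
      (𝓝 (pureFormula d p q (Df * t) ‖x - x₀ - t • b‖)) :=
    (tendsto_finsetSum _ fun i hi =>
      ((hs i (Finset.mem_range.1 hi)).hasSum.tendsto_sum_nat).const_mul _).const_mul _
  have h2 : Tendsto (fun N => u x t - pureFormulaTrunc d p q (Df * t) ‖x - x₀ - t • b‖ N) atTop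
      (𝓝 0) := by
    refine squeeze_zero_norm (a := fun N => |expansionTerm d p q (Df * t) ‖x - x₀ - t • b‖ (p * N)|)
      (fun N => ?_) ?_
    · rw [pureFormulaTrunc_eq_sum hd hq hτ]
      exact hu.abs_sub_sum_expansionTerm_le hd hp hq hDf ht x _
    · have h3 := (((hs 0 hp).tendsto_atTop_zero.const_mul (gammaFactor d p q (Df * t)
        ‖x - x₀ - t • b‖ 0)).const_mul (prefactor d p q (Df * t))).abs
      simp only [mul_zero, abs_zero] at h3
      refine h3.congr fun N => ?_
      rw [← expansionTerm_eq hd hq hτ _ hp, add_zero]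
  have h4 := h2.const_sub (u x t)
  simp only [sub_sub_cancel, sub_zero] at h4
  exact tendsto_nhds_unique h4 h1

/-- The change from the radial integral with density `r^{d-1}` to the Hankel form with `J_ν`. -/
theorem hankel_integrand_eq (hd : 0 < d) {y r j k : ℝ} (hy : 0 < y) (hr : 0 < r) (w : ℝ)
    (h : (2 * π) ^ ((d : ℝ) / 2) * j = (y * r) ^ (((d : ℝ) - 2) / 2) * k) :
    (r / (2 * π)) ^ ((d : ℝ) / 2) * j * w =
      y ^ (((d : ℝ) - 2) / 2) * ((2 * π) ^ d)⁻¹ * (r ^ (d - 1) * w * k) := by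
  have h2π : (0 : ℝ) < (2 * π) ^ ((d : ℝ) / 2) := by positivity
  have hj : j = (y * r) ^ (((d : ℝ) - 2) / 2) * k / (2 * π) ^ ((d : ℝ) / 2) := by
    rw [← h]; field_simp
  have e1 : r ^ ((d : ℝ) / 2) * r ^ (((d : ℝ) - 2) / 2) = r ^ (d - 1) := by
    rw [← rpow_add hr, ← rpow_natCast]
    congr 1
    rw [Nat.cast_pred hd]
    ring
  have e2 : (2 * π) ^ d = (2 * π) ^ ((d : ℝ) / 2) * (2 * π) ^ ((d : ℝ) / 2) := by
    rw [← rpow_add (by positivity), ← rpow_natCast]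
    congr 1
    ring
  rw [hj, div_rpow hr.le (by positivity), mul_rpow hy.le hr.le, e2, ← e1]
  field_simp

/-- The representation of the solution as a Hankel transform. -/
theorem IsFundamentalSolution.eq_hankel
    (hu : IsFundamentalSolution b x₀ 0 Df ((p : ℝ) / q) u) (hd : 0 < d) (hp : 0 < p) (hq : 0 < q)
    (hDf : 0 < Df) {t : ℝ} (ht : 0 < t) (x : EuclideanSpace ℝ (Fin d)) {y : ℝ}
    (hyx : y = ‖x - x₀ - t • b‖) (hy : 0 < y) :
    IntegrableOn (fun r : ℝ => (r / (2 * π)) ^ ((d : ℝ) / 2) *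
          besselJ (((d : ℝ) - 2) / 2) (y * r) * exp (-(Df * r ^ (2 * ((p : ℝ) / q)) * t)))
          (Ioi 0) ∧
        u x t = 1 / y ^ (((d : ℝ) - 2) / 2) * ∫ r in Ioi (0 : ℝ),
          (r / (2 * π)) ^ ((d : ℝ) / 2) * besselJ (((d : ℝ) - 2) / 2) (y * r) *
            exp (-(Df * r ^ (2 * ((p : ℝ) / q)) * t)) := by
  have : Nonempty (Fin d) := ⟨⟨0, hd⟩⟩
  obtain ⟨h1, h2⟩ := hu.eq_integral_sphereCos hd hDf (by positivity) ht x
  set X := x - x₀ - t • b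
  have hfun : ∀ r ∈ Ioi (0 : ℝ), y ^ (((d : ℝ) - 2) / 2) * ((2 * π) ^ d)⁻¹ *
      (r ^ (d - 1) * exp (-(Df * t) * r ^ (2 * ((p : ℝ) / q))) * sphereCos (r • X)) =
      (r / (2 * π)) ^ ((d : ℝ) / 2) * besselJ (((d : ℝ) - 2) / 2) (y * r) *
        exp (-(Df * r ^ (2 * ((p : ℝ) / q)) * t)) := by
    intro r hr
    have hr' : (0 : ℝ) < r := hr
    have hX : r • X ≠ 0 := smul_ne_zero hr'.ne' (norm_pos_iff.1 (hyx ▸ hy))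
    have hb := sphereCos_eq_besselJ hX
    rw [finrank_euclideanSpace_fin, norm_smul, norm_of_nonneg hr'.le, mul_comm r, ← hyx] at hb
    rw [hankel_integrand_eq hd hy hr' _ hb.symm]
    ring_nf
  refine ⟨IntegrableOn.congr_fun (h1.const_mul _) hfun measurableSet_Ioi, ?_⟩
  rw [← setIntegral_congr_fun measurableSet_Ioi hfun, integral_const_mul, h2,
    ← mul_assoc, ← mul_assoc, one_div, inv_mul_cancel₀ (by positivity), one_mul]

/-- Integrating a single term of the power series of `J_ν` in the Hankel form gives
`expansionTerm`. -/
theorem integral_hankel_besselTerm (hd : 0 < d) (hp : 0 < p) (hq : 0 < q)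
    (hDf : 0 < Df) {t : ℝ} (ht : 0 < t) {y : ℝ} (hy : 0 < y) (m : ℕ) :
    IntegrableOn (fun r : ℝ => (r / (2 * π)) ^ ((d : ℝ) / 2) *
          besselTerm (((d : ℝ) - 2) / 2) (y * r) m * exp (-(Df * r ^ (2 * ((p : ℝ) / q)) * t)))
          (Ioi 0) ∧
        1 / y ^ (((d : ℝ) - 2) / 2) * ∫ r in Ioi (0 : ℝ),
          (r / (2 * π)) ^ ((d : ℝ) / 2) * besselTerm (((d : ℝ) - 2) / 2) (y * r) m *
            exp (-(Df * r ^ (2 * ((p : ℝ) / q)) * t)) = expansionTerm d p q (Df * t) y m := by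
  obtain ⟨h1, h2⟩ := integral_expansionTerm hd hp hq (by positivity : 0 < Df * t) y m
  have hfun : ∀ r ∈ Ioi (0 : ℝ), y ^ (((d : ℝ) - 2) / 2) * ((2 * π) ^ d)⁻¹ *
      (r ^ (d - 1) * exp (-(Df * t) * r ^ (2 * ((p : ℝ) / q))) *
        ((-1) ^ m * (sphereCoeff d m * (y * r) ^ (2 * m)))) =
      (r / (2 * π)) ^ ((d : ℝ) / 2) * besselTerm (((d : ℝ) - 2) / 2) (y * r) m *
        exp (-(Df * r ^ (2 * ((p : ℝ) / q)) * t)) := by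
    intro r hr
    have hr' : (0 : ℝ) < r := hr
    rw [hankel_integrand_eq hd hy hr' _ (besselTerm_eq_sphereCoeff (mul_pos hy hr') m)]
    ring_nf
  refine ⟨IntegrableOn.congr_fun (h1.const_mul _) hfun measurableSet_Ioi, ?_⟩
  rw [← setIntegral_congr_fun measurableSet_Ioi hfun, integral_const_mul, ← h2,
    ← mul_assoc, ← mul_assoc, one_div, inv_mul_cancel₀ (by positivity), one_mul]

end Expansion

/-! ### The exponents one half and one third -/

theorem ringChoose_eq_ascPochhammer (a : ℂ) (n : ℕ) :
    Ring.choose (a + n - 1) n = (ascPochhammer ℂ n).eval a / n.factorial := by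
  have h1 := Ring.factorial_nsmul_multichoose_eq_ascPochhammer a n
  rw [Polynomial.ascPochhammer_smeval_eq_eval, nsmul_eq_mul] at h1
  have h2 : Ring.choose (a + n - 1) n = Ring.multichoose a n := by
    rw [Ring.choose]
    congr 1
    ring
  rw [h2, ← h1, mul_div_cancel_left₀ _ (by exact_mod_cast n.factorial_ne_zero)]

/-- The binomial series `₁F₀(a;;w) = (1 - w)^{-a}`. -/
theorem hasSum_hypTerm_singleton (a : ℂ) {w : ℂ} (hw : ‖w‖ < 1) :
    HasSum (hypTerm {a} 0 w) (1 / (1 - w) ^ a) := by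
  have h := (Complex.one_div_one_sub_cpow_hasFPowerSeriesOnBall_zero a).hasSum (y := w)
    (by simpa [enorm_eq_nnnorm, ← NNReal.coe_lt_coe] using hw)
  simp only [zero_add] at h
  refine h.congr_fun fun n => ?_
  rw [FormalMultilinearSeries.ofScalars_apply_eq, ringChoose_eq_ascPochhammer]
  simp [hypTerm]
  ring

theorem analyticOnNhd_one_div_one_sub_cpow (a : ℂ) :
    AnalyticOnNhd ℂ (fun w : ℂ => 1 / (1 - w) ^ a) {w | 1 - w ∈ Complex.slitPlane} := by
  intro w hw
  refine analyticAt_const.div ((analyticAt_const.sub analyticAt_id).cpow analyticAt_const hw) ?_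
  exact fun h => Complex.slitPlane_ne_zero hw (Complex.cpow_eq_zero_iff _ _ |>.1 h).1

/-- The Poisson kernel, up to a constant, in the complexified distance: `z = i y` gives
`(1 + y² / τ²)^{-a}`. -/
theorem analyticAt_poisson (a : ℂ) {τ : ℝ} {z : ℂ} (hz : z.re ∈ Ioo (-τ) τ) :
    AnalyticAt ℂ (fun z : ℂ => 1 / (1 - z ^ 2 / (τ : ℂ) ^ 2) ^ a) z := by
  have hτ : 0 < τ := by have := hz.1.trans hz.2; linarith
  have hre : (1 - z ^ 2 / (τ : ℂ) ^ 2).re = 1 - (z.re ^ 2 - z.im ^ 2) / τ ^ 2 := by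
    rw [← Complex.ofReal_pow, Complex.sub_re, Complex.div_ofReal_re, pow_two z, Complex.mul_re,
      Complex.one_re]
    ring
  have hslit : 1 - z ^ 2 / (τ : ℂ) ^ 2 ∈ Complex.slitPlane := by
    left
    rw [hre, sub_pos, div_lt_one (by positivity)]
    have := sq_lt_sq' hz.1 hz.2
    nlinarith [sq_nonneg z.im]
  have h1 : AnalyticAt ℂ (fun z : ℂ => z ^ 2 / (τ : ℂ) ^ 2) z := by fun_prop
  have h2 : AnalyticAt ℂ (fun w : ℂ => 1 / (1 - w) ^ a) ((fun z : ℂ => z ^ 2 / (τ : ℂ) ^ 2) z) :=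
    analyticOnNhd_one_div_one_sub_cpow a _ hslit
  exact AnalyticAt.comp (f := fun z : ℂ => z ^ 2 / (τ : ℂ) ^ 2) (x := z) h2 h1

theorem upperParams_half (d : ℕ) : upperParams d 1 2 0 = {((d : ℝ) + 1) / 2} := by
  simp [upperParams, Multiset.bind_def, Multiset.pure_def]
  ring

theorem lowerParams_one (d : ℕ) : lowerParams d 1 0 = 0 := by
  simp [lowerParams, Multiset.bind_def, Multiset.pure_def]

theorem ofReal_hypTerm (a b : Multiset ℝ) (w : ℝ) (n : ℕ) :
    ((hypTerm a b w n : ℝ) : ℂ) =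
      hypTerm (a.map fun c : ℝ => (c : ℂ)) (b.map fun c : ℝ => (c : ℂ)) (w : ℂ) n := by
  have hm : ∀ s : Multiset ℝ, (((s.map fun c => (ascPochhammer ℝ n).eval c).prod : ℝ) : ℂ) =
      ((s.map fun c : ℝ => (c : ℂ)).map fun c => (ascPochhammer ℂ n).eval c).prod := by
    intro s
    rw [← Complex.ofRealHom_eq_coe, map_multiset_prod, Multiset.map_map, Multiset.map_map]
    congr 1
    refine Multiset.map_congr rfl fun c _ => ?_
    simp [ascPochhammer_eval_eq_prod]
  rw [hypTerm, hypTerm, ← hm, ← hm]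
  push_cast
  rfl

section Poisson

variable {d : ℕ}

/-- The measure with density `exp (-τ ‖ξ‖)`, whose Fourier transform is the solution for
`α = 1/2`. -/
noncomputable def expNormMeasure (d : ℕ) (τ : ℝ) : Measure (EuclideanSpace ℝ (Fin d)) :=
  volume.withDensity fun ξ => ENNReal.ofReal (exp (-τ * ‖ξ‖))

theorem integral_expNormMeasure (τ : ℝ) (f : EuclideanSpace ℝ (Fin d) → ℂ) :
    ∫ ξ, f ξ ∂expNormMeasure d τ = ∫ ξ, f ξ * (exp (-τ * ‖ξ‖) : ℝ) := by
  have hm : Measurable fun ξ : EuclideanSpace ℝ (Fin d) => (exp (-τ * ‖ξ‖)).toNNReal := by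
    fun_prop
  rw [expNormMeasure]
  simp only [ENNReal.ofReal]
  rw [integral_withDensity_eq_integral_smul hm]
  refine integral_congr_ae (.of_forall fun ξ => ?_)
  simp only [NNReal.smul_def, Real.coe_toNNReal _ (exp_pos _).le, Complex.real_smul]
  ring

/-- `complexMGF` of a unit direction is analytic on the strip of half-width `τ`, because
`exp (s ⟪ξ, e⟫ - τ ‖ξ‖)` is integrable for `|s| < τ`. -/
theorem Ioo_subset_integrableExpSet (hd : 0 < d) {τ : ℝ} {e : EuclideanSpace ℝ (Fin d)}
    (he : ‖e‖ = 1) :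
    Ioo (-τ) τ ⊆ ProbabilityTheory.integrableExpSet (fun ξ => ⟪ξ, e⟫) (expNormMeasure d τ) := by
  intro s hs
  have hm : Measurable fun ξ : EuclideanSpace ℝ (Fin d) => (exp (-τ * ‖ξ‖)).toNNReal := by
    fun_prop
  simp only [ProbabilityTheory.integrableExpSet, mem_ofPred_eq, expNormMeasure, ENNReal.ofReal]
  rw [integrable_withDensity_iff_integrable_smul hm]
  have hs' : 0 < τ - |s| := sub_pos.2 (abs_lt.2 hs)
  have hi := integrable_exp_neg_mul_norm_rpow hd hs' one_pos
  simp only [rpow_one] at hi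
  refine hi.mono' (by
    simp only [NNReal.smul_def, Real.coe_toNNReal _ (exp_pos _).le]
    fun_prop) (.of_forall fun ξ => ?_)
  simp only [NNReal.smul_def, Real.coe_toNNReal _ (exp_pos _).le, smul_eq_mul]
  rw [← exp_add, norm_of_nonneg (exp_pos _).le, exp_le_exp]
  have h1 : |⟪ξ, e⟫| ≤ ‖ξ‖ := by simpa [he] using abs_real_inner_le_norm ξ e
  have h2 : s * ⟪ξ, e⟫ ≤ |s| * ‖ξ‖ :=
    (le_abs_self _).trans ((abs_mul _ _).trans_le (by gcongr))
  linarith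

theorem hypArg_half (τ y : ℝ) : hypArg 1 2 τ y = -(y ^ 2 / τ ^ 2) := by
  have h : ((2 : ℕ) : ℝ) / ((1 : ℕ) : ℝ) = (2 : ℕ) := by norm_num
  rw [hypArg, zVar, h, rpow_natCast]
  field_simp
  norm_num

theorem gammaFactor_zero (p q : ℕ) (τ y : ℝ) :
    gammaFactor d p q τ y 0 = gammaFactor d p q τ 0 0 := by
  simp [gammaFactor]

theorem pureFormula_half {τ y : ℝ} (hτ : 0 < τ) (hy0 : 0 ≤ y) (hy : y < τ) :
    (pureFormula d 1 2 τ y : ℂ) = prefactor d 1 2 τ * (gammaFactor d 1 2 τ 0 0 *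
      (1 / (1 - (hypArg 1 2 τ y : ℝ)) ^ (((d : ℂ) + 1) / 2))) := by
  have hw : ‖((hypArg 1 2 τ y : ℝ) : ℂ)‖ < 1 := by
    rw [hypArg_half, Complex.norm_real, norm_neg, norm_of_nonneg (by positivity), ← div_pow]
    exact pow_lt_one₀ (by positivity) ((div_lt_one hτ).2 hy) two_ne_zero
  have h : ((hypFun (upperParams d 1 2 0) (lowerParams d 1 0) (hypArg 1 2 τ y) : ℝ) : ℂ) =
      1 / (1 - (hypArg 1 2 τ y : ℝ)) ^ (((d : ℂ) + 1) / 2) := by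
    rw [hypFun, Complex.ofReal_tsum]
    simp_rw [ofReal_hypTerm]
    rw [upperParams_half, lowerParams_one]
    simp only [Multiset.map_singleton, Multiset.map_zero]
    push_cast
    exact (hasSum_hypTerm_singleton _ hw).tsum_eq
  rw [pureFormula, Finset.sum_range_one, gammaFactor_zero, Complex.ofReal_mul,
    Complex.ofReal_mul, h]

variable {b x₀ : EuclideanSpace ℝ (Fin d)} {Df : ℝ} {u : EuclideanSpace ℝ (Fin d) → ℝ → ℝ}

/-- For `α = 1/2` the solution is the Poisson kernel at every distance `y`. Both sides are analytic
in the complexified distance on a strip, and the power series gives their equality near `y = 0`. -/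
theorem IsFundamentalSolution.eq_poisson
    (hu : IsFundamentalSolution b x₀ 0 Df (((1 : ℕ) : ℝ) / (2 : ℕ)) u) (hd : 0 < d)
    (hDf : 0 < Df) {t : ℝ} (ht : 0 < t) (x : EuclideanSpace ℝ (Fin d)) :
    (u x t : ℂ) = prefactor d 1 2 (Df * t) * (gammaFactor d 1 2 (Df * t) 0 0 *
      (1 / (1 - (hypArg 1 2 (Df * t) ‖x - x₀ - t • b‖ : ℝ)) ^ (((d : ℂ) + 1) / 2))) := by
  have : Nonempty (Fin d) := ⟨⟨0, hd⟩⟩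
  set τ := Df * t with hτdef
  have hτ : 0 < τ := by positivity
  set X := x - x₀ - t • b with hX
  set y := ‖X‖ with hy
  obtain ⟨e, he, hXe⟩ : ∃ e : EuclideanSpace ℝ (Fin d), ‖e‖ = 1 ∧ X = y • e := by
    by_cases hX0 : X = 0
    · obtain ⟨e, he⟩ := exists_norm_eq (EuclideanSpace ℝ (Fin d)) zero_le_one
      exact ⟨e, he, by simp [hy, hX0]⟩
    · have : ‖X‖ ≠ 0 := norm_ne_zero_iff.2 hX0
      exact ⟨‖X‖⁻¹ • X, by rw [norm_smul, norm_inv, norm_norm, inv_mul_cancel₀ this],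
        by simp [hy, smul_smul, this]⟩
  -- the solution on the line through the centre, as a value of the moment generating function
  set f := ProbabilityTheory.complexMGF (fun ξ => ⟪ξ, e⟫) (expNormMeasure d τ)
  have hline : ∀ s : ℝ, (u (x₀ + t • b + s • e) t : ℂ) =
      ((2 * π) ^ d : ℂ)⁻¹ * f (s * Complex.I) := by
    intro s
    rw [hu.eq_integral_cexp hd hDf (by norm_num) ht, show f (s * Complex.I) = _ from
      integral_expNormMeasure τ _]
    congr 1
    refine integral_congr_ae (.of_forall fun ξ => ?_)
    have e1 : x₀ + t • b + s • e - x₀ - t • b = s • e := by abel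
    have e2 : 2 * (((1 : ℕ) : ℝ) / (2 : ℕ)) = 1 := by norm_num
    simp only [e1, e2, rpow_one, real_inner_smul_right]
    congr 2
    push_cast
    ring
  set C : ℂ := (2 * π) ^ d * (prefactor d 1 2 τ * gammaFactor d 1 2 τ 0 0) with hC
  set g : ℂ → ℂ := fun z => C * (1 / (1 - z ^ 2 / (τ : ℂ) ^ 2) ^ (((d : ℂ) + 1) / 2)) with hg
  set S : Set ℂ := {z | z.re ∈ Ioo (-τ) τ} with hS
  have hf : AnalyticOnNhd ℂ f S := ProbabilityTheory.analyticOnNhd_complexMGF.mono fun z hz =>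
    interior_maximal (Ioo_subset_integrableExpSet hd he) isOpen_Ioo hz
  have hga : AnalyticOnNhd ℂ g S := by
    intro z hz
    exact analyticAt_const.mul (analyticAt_poisson _ hz)
  have hSc : IsPreconnected S :=
    ((convex_Ioo (-τ) τ).linear_preimage Complex.reLm).isPreconnected
  have hgI : ∀ s : ℝ, g (s * Complex.I) =
      C * (1 / (1 - (hypArg 1 2 τ s : ℝ)) ^ (((d : ℂ) + 1) / 2)) := by
    intro s
    simp only [hg, hypArg_half, mul_pow, Complex.I_sq]
    push_cast
    congr 4
    ring
  have hpi : ((2 * π) ^ d : ℂ) ≠ 0 := by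
    have := pi_ne_zero
    simp [this]
  have hnear : ∀ s ∈ Ioo 0 τ, f (s * Complex.I) = g (s * Complex.I) := by
    intro s hs
    have e1 : x₀ + t • b + s • e - x₀ - t • b = s • e := by abel
    have e2 : ‖s • e‖ = s := by rw [norm_smul, he, mul_one, norm_of_nonneg hs.1.le]
    have h1 := (hu.eq_pureFormula hd one_pos two_pos hDf ht (x₀ + t • b + s • e)
      (Or.inr (Or.inl ⟨rfl, by rw [e1, e2]; exact hs.2⟩))).2
    rw [e1, e2] at h1
    have h2 := hline s
    rw [h1, pureFormula_half hτ hs.1.le hs.2, eq_inv_mul_iff_mul_eq₀ hpi] at h2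
    rw [← h2, hgI, hC]
    ring
  have hfreq : ∃ᶠ z in 𝓝[≠] (0 : ℂ), f z = g z := by
    have ht0 : Tendsto (fun s : ℝ => (s : ℂ) * Complex.I) (𝓝[>] 0) (𝓝[≠] 0) := by
      refine tendsto_nhdsWithin_iff.2 ⟨?_, ?_⟩
      · have : Continuous fun s : ℝ => (s : ℂ) * Complex.I := by fun_prop
        simpa using (this.tendsto 0).mono_left nhdsWithin_le_nhds
      · filter_upwards [self_mem_nhdsWithin] with s hs
        have : s ≠ 0 := (mem_Ioi.1 hs).ne'
        simp [this]
    refine ht0.frequently (Eventually.frequently ?_)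
    filter_upwards [Ioo_mem_nhdsGT hτ] with s hs using hnear s hs
  have heq := hf.eqOn_of_preconnected_of_frequently_eq hga hSc (z₀ := 0) (by simp [hS, hτ]) hfreq
  have hyS : (y : ℂ) * Complex.I ∈ S := by simp [hS, hτ]
  have hxy : x = x₀ + t • b + y • e := by rw [← hXe, hX]; abel
  have h3 := hline y
  rw [← hxy, heq hyS, hgI, hC] at h3
  rw [h3]
  field_simp

end Poisson

section OneThird

variable {d : ℕ}

theorem pureFormulaTrunc_one_third {τ : ℝ} (hτ : 0 < τ) (y : ℝ) (N : ℕ) :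
    pureFormulaTrunc d 1 3 τ y N = unitSphereArea d * Gamma (3 * (d : ℝ) / 2 + 1) /
            ((2 * π) ^ d * τ ^ (3 * (d : ℝ) / 2) * d) *
          ∑ n ∈ Finset.range N, hypTerm {(d : ℝ) / 2 + 1 / 3, (d : ℝ) / 2 + 2 / 3} 0
            (-(3 ^ 3 * (y / 2) ^ 2 / τ ^ 3)) n := by
  have h1 : upperParams d 1 3 0 = {(d : ℝ) / 2 + 1 / 3, (d : ℝ) / 2 + 2 / 3} := by
    have h3 : (Finset.Icc 1 (3 - 1)).val = {1, 2} := rfl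
    simp [upperParams, Multiset.bind_def, Multiset.pure_def, h3]
  have h2 : hypArg 1 3 τ y = -(3 ^ 3 * (y / 2) ^ 2 / τ ^ 3) := by
    have h : ((3 : ℕ) : ℝ) / ((1 : ℕ) : ℝ) = (3 : ℕ) := by norm_num
    rw [hypArg, zVar, h, rpow_natCast]
    push_cast
    ring
  have e1 : -(d : ℝ) / (2 * ((1 : ℕ) : ℝ) / ((3 : ℕ) : ℝ)) = -(3 * (d : ℝ) / 2) := by
    push_cast; ring
  have e2 : ((d : ℝ) + 2 * ((0 : ℕ) : ℝ)) / (2 * ((1 : ℕ) : ℝ) / ((3 : ℕ) : ℝ)) =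
      3 * (d : ℝ) / 2 := by
    push_cast; ring
  rw [pureFormulaTrunc, Finset.sum_range_one, h1, h2, lowerParams_one, prefactor, gammaFactor, e1,
    e2, rpow_neg hτ.le]
  simp only [mul_zero, add_zero, pow_zero, Nat.factorial_zero, Nat.cast_one, Nat.cast_zero,
    mul_one, one_mul]
  ring

end OneThird

end

theorem mainTheorem4 (d : ℕ) (hd : 1 ≤ d) (p q : ℕ) (hp : 0 < p) (hpq : p < q)
    (hcop : Nat.Coprime p q) (b x₀ : EuclideanSpace ℝ (Fin d)) (Df : ℝ) (hDf : 0 < Df)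
    (u : EuclideanSpace ℝ (Fin d) → ℝ → ℝ)
    (hu : IsFundamentalSolution b x₀ 0 Df ((p : ℝ) / q) u) :
    -- the formula holds, with convergent series, if `α > 1/2`, if `α = 1/2` and `y < D_f t`,
    -- and if `y = 0`
    (∀ x t, 0 < t →
      (q < 2 * p ∨ (q = 2 * p ∧ ‖x - x₀ - t • b‖ < Df * t) ∨ ‖x - x₀ - t • b‖ = 0) →
      (∀ i < p, Summable
        (hypTerm (upperParams d p q i) (lowerParams d p i)
          (hypArg p q (Df * t) ‖x - x₀ - t • b‖))) ∧
      u x t = pureFormula d p q (Df * t) ‖x - x₀ - t • b‖) ∧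
    -- if `α = 1/2`, the formula holds for all `y`, with the hypergeometric function continued
    -- analytically from the unit disc to the complex plane cut along `[1, ∞)`
    (q = 2 * p → ∃ F : ℕ → ℂ → ℂ,
      (∀ i < p, AnalyticOnNhd ℂ (F i) {w | 1 - w ∈ Complex.slitPlane} ∧
        ∀ w : ℂ, ‖w‖ < 1 →
          HasSum (hypTerm ((upperParams d p q i).map fun c : ℝ => (c : ℂ))
            ((lowerParams d p i).map fun c : ℝ => (c : ℂ)) w) (F i w)) ∧
      ∀ x t, 0 < t →
        (u x t : ℂ) = (prefactor d p q (Df * t) : ℂ) * ∑ i ∈ Finset.range p,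
          (gammaFactor d p q (Df * t) ‖x - x₀ - t • b‖ i : ℂ) *
            F i (hypArg p q (Df * t) ‖x - x₀ - t • b‖ : ℝ)) ∧
    -- if `α < 1/2`, the hypergeometric series diverge for `y ≠ 0`
    (2 * p < q → ∀ τ y : ℝ, 0 < τ → 0 < y → ∀ i < p, ¬ ∃ L : ℝ, Tendsto
      (fun N => ∑ n ∈ Finset.range N,
        hypTerm (upperParams d p q i) (lowerParams d p i) (hypArg p q τ y) n) atTop (𝓝 L)) ∧
    -- for every `α`, the formula is the result of term-by-term integration of the power series of
    -- the Bessel function in the integral representation of the solution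
    (∀ x t, 0 < t → ∀ y, y = ‖x - x₀ - t • b‖ → 0 < y →
      (IntegrableOn (fun r : ℝ => (r / (2 * π)) ^ ((d : ℝ) / 2) *
          besselJ (((d : ℝ) - 2) / 2) (y * r) * exp (-(Df * r ^ (2 * ((p : ℝ) / q)) * t)))
          (Ioi 0) ∧
        u x t = 1 / y ^ (((d : ℝ) - 2) / 2) * ∫ r in Ioi (0 : ℝ),
          (r / (2 * π)) ^ ((d : ℝ) / 2) * besselJ (((d : ℝ) - 2) / 2) (y * r) *
            exp (-(Df * r ^ (2 * ((p : ℝ) / q)) * t))) ∧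
      ∀ i < p, ∀ n : ℕ,
        IntegrableOn (fun r : ℝ => (r / (2 * π)) ^ ((d : ℝ) / 2) *
          besselTerm (((d : ℝ) - 2) / 2) (y * r) (p * n + i) *
            exp (-(Df * r ^ (2 * ((p : ℝ) / q)) * t))) (Ioi 0) ∧
        1 / y ^ (((d : ℝ) - 2) / 2) * ∫ r in Ioi (0 : ℝ),
          (r / (2 * π)) ^ ((d : ℝ) / 2) * besselTerm (((d : ℝ) - 2) / 2) (y * r) (p * n + i) *
            exp (-(Df * r ^ (2 * ((p : ℝ) / q)) * t)) =
          prefactor d p q (Df * t) * (gammaFactor d p q (Df * t) y i *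
            hypTerm (upperParams d p q i) (lowerParams d p i) (hypArg p q (Df * t) y) n)) ∧
    -- for every `α`, the formula is the complete asymptotic expansion of the solution as `y → 0`
    (∀ t, 0 < t → ∀ N : ℕ,
      (fun x => u x t - pureFormulaTrunc d p q (Df * t) ‖x - x₀ - t • b‖ N)
        =O[𝓝 (x₀ + t • b)] fun x => ‖x - x₀ - t • b‖ ^ (2 * p * N)) ∧
    -- the case `α = 1/3`: the formula is, term by term, a single `_2F_0`
    (p = 1 → q = 3 →
      (∀ τ y : ℝ, 0 < τ → ∀ N : ℕ, pureFormulaTrunc d p q τ y N =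
        unitSphereArea d * Gamma (3 * (d : ℝ) / 2 + 1) /
            ((2 * π) ^ d * τ ^ (3 * (d : ℝ) / 2) * d) *
          ∑ n ∈ Finset.range N, hypTerm {(d : ℝ) / 2 + 1 / 3, (d : ℝ) / 2 + 2 / 3} 0
            (-(3 ^ 3 * (y / 2) ^ 2 / τ ^ 3)) n) ∧
      ∀ t, 0 < t → ∀ N : ℕ,
        (fun x => u x t -
          unitSphereArea d * Gamma (3 * (d : ℝ) / 2 + 1) /
              ((2 * π) ^ d * (Df * t) ^ (3 * (d : ℝ) / 2) * d) *
            ∑ n ∈ Finset.range N, hypTerm {(d : ℝ) / 2 + 1 / 3, (d : ℝ) / 2 + 2 / 3} 0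
              (-(3 ^ 3 * (‖x - x₀ - t • b‖ / 2) ^ 2 / (Df * t) ^ 3)) n)
          =O[𝓝 (x₀ + t • b)] fun x => ‖x - x₀ - t • b‖ ^ (2 * N)) := by
  have hd0 : 0 < d := hd
  have hq : 0 < q := hp.trans hpq
  refine ⟨fun x t ht h => hu.eq_pureFormula hd0 hp hq hDf ht x h, ?_,
    fun h τ y hτ hy i hi => hypTerm_params_not_convergent hd h hi hτ hy, ?_,
    fun t ht N => hu.isBigO_sub_pureFormulaTrunc hd0 hp hq hDf ht N, ?_⟩
  · intro hq2
    -- in lowest terms, `α = 1/2` means `p = 1` and `q = 2`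
    obtain rfl : p = 1 := Nat.Coprime.eq_one_of_dvd hcop (Dvd.intro_left 2 hq2.symm)
    subst hq2
    refine ⟨fun _ w => 1 / (1 - w) ^ (((d : ℂ) + 1) / 2), fun i hi =>
      ⟨analyticOnNhd_one_div_one_sub_cpow _, fun w hw => ?_⟩, fun x t ht => ?_⟩
    · obtain rfl : i = 0 := by omega
      rw [mul_one, upperParams_half, lowerParams_one]
      simpa using hasSum_hypTerm_singleton (((d : ℂ) + 1) / 2) hw
    · rw [Finset.sum_range_one, gammaFactor_zero]
      exact hu.eq_poisson hd0 hDf ht x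
  · intro x t ht y hyx hy
    refine ⟨hu.eq_hankel hd0 hp hq hDf ht x hyx hy, fun i hi n => ?_⟩
    rw [← expansionTerm_eq hd hq (by positivity) y hi n]
    exact integral_hankel_besselTerm hd0 hp hq hDf ht hy _
  · rintro rfl rfl
    refine ⟨fun τ y hτ N => pureFormulaTrunc_one_third hτ y N, fun t ht N => ?_⟩
    have h := hu.isBigO_sub_pureFormulaTrunc hd0 one_pos hq hDf ht N
    simp_rw [pureFormulaTrunc_one_third (mul_pos hDf ht), mul_one] at h
    exact h
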